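/- Let $\mathbb{D}=\{z\in\mathbb{C}:|z|<1\}$, $\mathbb{T}=\partial\mathbb{D}$ and $\overline{\mathbb{D}}=\mathbb{D}\cup\mathbb{T}$. For $u\in\mathcal{C}(\mathbb{T})$ let $\mathcal{P}_u(z)=\frac{1}{2\pi}\int_0^{2\pi}\frac{1-|z|^2}{|1-ze^{-it}|^2}\,u(e^{it})\,dt$ ($z\in\mathbb{D}$) be its Poisson integral, and put $\|\mathcal{P}_u\|_\infty=\sup_{z\in\mathbb{D}}|\mathcal{P}_u(z)|$; $\Delta$ denotes the Laplacian and $f_{\overline z}=\frac12(f_x+if_y)$. Suppose that $g\in\mathcal{C}(\overline{\mathbb{D}})$, $\varphi\in\mathcal{C}(\mathbb{T})$, that $\phi\in\mathcal{C}(\overline{\mathbb{D}})$ is analytic in $\mathbb{D}$ with $|\phi|\le1$, and that $f\in\mathcal{C}^4(\mathbb{D})$ satisfies $$\Delta(\Delta f)=g\ \text{ in }\mathbb{D},\qquad f_{\overline z}=\varphi\ \text{ on }\mathbb{T},\qquad f=\phi\ \text{ on }\mathbb{T},$$ where the boundary conditions mean that $f_{\overline z}(z)\to\varphi(\zeta)$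 and $f(z)\to\phi(\zeta)=:f(\zeta)$ as $z\to\zeta$ in $\mathbb{D}$, for every $\zeta\in\mathbb{T}$. Let $\varphi_1(e^{it})=\varphi(e^{it})e^{-it}$, and assume that $$\|\mathcal{P}_{\varphi_1}\|_\infty<\tfrac12\qquad\text{and}\qquad|\mathcal{P}_\phi(0)|<\frac{1-2\|\mathcal{P}_{\varphi_1}\|_\infty}{1+2\|\mathcal{P}_{\varphi_1}\|_\infty}.$$ If $\eta\in\mathbb{T}$ and $\lim_{r\to1^-}|f(r\eta)|=1$, then $$\liminf_{r\to1^-}\frac{|f(\eta)-f(r\eta)|}{1-r}\ \ge\ \frac{1-|\mathcal{P}_\phi(0)|}{1+|\mathcal{P}_\phi(0)|}-2\|\mathcal{P}_{\varphi_1}\|_\infty,$$ where the left-hand side may be $+\infty$. Moreover, the inequality is sharp when $\|\mathcal{P}_{\varphi_1}\|_\infty=0$: for every $w\in\mathbb{D}$ and every $\eta\in\mathbb{T}$ there are $g,\varphi,\phi,f$ satisfying all the hypotheses above, with $\|\mathcal{P}_{\varphi_1}\|_\infty=0$, $\mathcal{P}_\phi(0)=w$ and $\lim_{r\to1^-}|f(r\eta)|=1$,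 for which equality holds. -/

import Mathlib

open Set Filter Topology Metric
open scoped InnerProductSpace Laplacian ComplexConjugate

noncomputable section

namespace BoundarySchwarz

/-- The Wirtinger derivative `f_{z̄} = (f_x + i f_y) / 2`. -/
def dbar (f : ℂ → ℂ) (z : ℂ) : ℂ :=
  (1 / 2 : ℂ) * (fderiv ℝ f z 1 + Complex.I * fderiv ℝ f z Complex.I)

/-- The Poisson integral over the unit circle,
`P_u(z) = (1 / 2π) ∫₀^{2π} (1 - |z|²) / |1 - z e^{-it}|² · u(e^{it}) dt`.
Only the values of `u` on the unit circle matter; `z` is meant to lie in the open unit disk. -/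
def poissonIntegral (u : ℂ → ℂ) (z : ℂ) : ℂ :=
  Real.circleAverage (fun ζ => poissonKernel 0 z ζ • u ζ) 0 1

/-- `‖u‖_∞ = sup { |u(z)| : |z| < 1 }`. -/
def diskSup (u : ℂ → ℂ) : ℝ :=
  ⨆ z : ball (0 : ℂ) 1, ‖u z‖

/-- `φ₁(ζ) = φ(ζ) ζ̄` for `ζ` on the unit circle, that is, `φ₁(e^{it}) = φ(e^{it}) e^{-it}`. -/
def twist (φ : ℂ → ℂ) (ζ : ℂ) : ℂ :=
  φ ζ * conj ζ

/-- `f` is a classical solution, of class `C⁴` in the open unit disk, of `Δ(Δ f) = g` in the disk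
with `f_{z̄} = φ` and `f = Φ` on the unit circle. Here `g` is continuous on the closed disk and
`φ` on the circle. The boundary conditions say that `f` and `f_{z̄}`, which are given in the open
disk, extend continuously to the circle by `Φ` and `φ`; the values of `f` on the circle are those
of the extension. -/
structure IsSolution (g φ Φ f : ℂ → ℂ) : Prop where
  continuousOn_g : ContinuousOn g (closedBall 0 1)
  continuousOn_φ : ContinuousOn φ (sphere 0 1)
  contDiffOn : ContDiffOn ℝ 4 f (ball 0 1)
  biharmonic : ∀ z ∈ ball (0 : ℂ) 1, Δ (Δ f) z = g z
  tendsto_dbar : ∀ ζ ∈ sphere (0 : ℂ) 1, Tendsto (dbar f) (𝓝[ball 0 1] ζ) (𝓝 (φ ζ))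
  tendsto : ∀ ζ ∈ sphere (0 : ℂ) 1, Tendsto f (𝓝[ball 0 1] ζ) (𝓝 (Φ ζ))
  eq_on_circle : ∀ ζ ∈ sphere (0 : ℂ) 1, f ζ = Φ ζ

/-- The standing hypotheses of the boundary Schwarz lemma: `f` solves the boundary value problem
with data `g, φ, Φ`, where `Φ` is continuous on the closed disk, analytic in the open disk and
bounded by `1`, `‖P_{φ₁}‖_∞ < 1/2`, and
`|P_Φ(0)| < (1 - 2 ‖P_{φ₁}‖_∞) / (1 + 2 ‖P_{φ₁}‖_∞)`. -/
structure IsAdmissible (g φ Φ f : ℂ → ℂ) : Prop extends IsSolution g φ Φ f where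
  continuousOn_Φ : ContinuousOn Φ (closedBall 0 1)
  analytic_Φ : DifferentiableOn ℂ Φ (ball 0 1)
  norm_Φ_le : ∀ z ∈ closedBall (0 : ℂ) 1, ‖Φ z‖ ≤ 1
  diskSup_lt : diskSup (poissonIntegral (twist φ)) < 1 / 2
  center_lt : ‖poissonIntegral Φ 0‖ <
    (1 - 2 * diskSup (poissonIntegral (twist φ))) / (1 + 2 * diskSup (poissonIntegral (twist φ)))

/-- The lower limit `liminf_{r → 1⁻} |f(η) - f(rη)| / (1 - r)`, in the extended reals since it may
be `+∞`. -/
def radialLiminf (f : ℂ → ℂ) (η : ℂ) : EReal :=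
  liminf (fun r : ℝ => ((‖f η - f (r * η)‖ / (1 - r) : ℝ) : EReal)) (𝓝[<] (1 : ℝ))

/-- The bound `(1 - |P_Φ(0)|) / (1 + |P_Φ(0)|) - 2 ‖P_{φ₁}‖_∞`. -/
def schwarzBound (φ Φ : ℂ → ℂ) : ℝ :=
  (1 - ‖poissonIntegral Φ 0‖) / (1 + ‖poissonIntegral Φ 0‖)
    - 2 * diskSup (poissonIntegral (twist φ))

end BoundarySchwarz

end

noncomputable section

namespace BoundarySchwarz

open MeasureTheory

/-! Put h = f - Φ. Since Φ is analytic, h has the same bilaplacian and the same ∂̄-data φ as f, but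
zero boundary values. The heart of the proof is the radial expansion h(rη) + (1 - r²) P_{φ₁}(rη) =
o(1 - r), `tendsto_biharmonic_radial`, obtained without a Green function.

On circles of radius r, the operators ∂_x ± i∂_y turn the n-th Fourier mode of Δ(Δh) = g into a
chain of four first-order linear equations in r. Regularity at the origin controls two of them and
the boundary data the other two. This leaves an error in mode n that is o(1 - r) and at most 2M(1 -
r)/(|n| + 2)², with M a bound for g (`radial_biharmonic_estimate`). The bounds are summable in n, so
dominated convergence and Fourier inversion give the expansion.

With a = |Φ(0)|, Schwarz–Pick gives |Φ(rη)| ≤ (a + r)/(1 + ar). As |f(η)| = 1, the quotient |f(η) -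
f(rη)|/(1 - r) is at least (1 - |f(rη)|)/(1 - r), and inserting both estimates yields the bound.
Equality occurs for f = Φ a disk automorphism whose image of the radius to η is itself radial. -/

/-- The `n`-th Fourier coefficient of `u` on the circle of radius `r` about the origin. -/
def circleCoeff (u : ℂ → ℂ) (n : ℤ) (r : ℝ) : ℂ :=
  (2 * Real.pi : ℂ)⁻¹ * ∫ θ in (0 : ℝ)..2 * Real.pi,
    u (circleMap 0 r θ) * Complex.exp (-(n * θ * Complex.I))

/-- The first-order operator `∂_x + s i ∂_y`. -/
def dirD (s : ℤ) (v : ℂ → ℂ) (z : ℂ) : ℂ :=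
  fderiv ℝ v z 1 + s * Complex.I * fderiv ℝ v z Complex.I

/-! ### Fourier coefficients on circles and their dependence on the radius -/

lemma norm_exp_coeff (n : ℤ) (θ : ℝ) : ‖Complex.exp (-(n * θ * Complex.I))‖ = 1 := by
  have : (-(n * θ * Complex.I) : ℂ) = ((-(n * θ) : ℝ) : ℂ) * Complex.I := by push_cast; ring
  rw [this, Complex.norm_exp_ofReal_mul_I]

lemma circleMap_mem_unit_ball {r : ℝ} (h0 : 0 ≤ r) (h1 : r < 1) (θ : ℝ) :
    circleMap 0 r θ ∈ ball (0 : ℂ) 1 := by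
  simpa [abs_of_nonneg h0] using h1

lemma norm_circleCoeff_le {u : ℂ → ℂ} {n : ℤ} {r K : ℝ}
    (h : ∀ θ : ℝ, ‖u (circleMap 0 r θ)‖ ≤ K) : ‖circleCoeff u n r‖ ≤ K := by
  have hpi := Real.pi_pos
  have := intervalIntegral.norm_integral_le_of_norm_le_const (a := 0) (b := 2 * Real.pi)
    (f := fun θ : ℝ => u (circleMap 0 r θ) * Complex.exp (-(n * θ * Complex.I))) (C := K)
    (fun θ _ => by rw [norm_mul, norm_exp_coeff, mul_one]; exact h θ)
  rw [circleCoeff, norm_mul, norm_inv, norm_mul, Complex.norm_real, Complex.norm_two,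
    Real.norm_eq_abs, abs_of_pos hpi, inv_mul_le_iff₀ (by positivity)]
  rw [sub_zero, abs_of_pos (by positivity)] at this
  linarith

lemma circleCoeff_congr {u v : ℂ → ℂ} {r : ℝ} (h : ∀ θ : ℝ, u (circleMap 0 r θ) = v (circleMap 0 r θ))
    (n : ℤ) : circleCoeff u n r = circleCoeff v n r := by
  simp only [circleCoeff, h]

lemma circleCoeff_const_mul (c : ℂ) (u : ℂ → ℂ) (n : ℤ) (r : ℝ) :
    circleCoeff (fun z => c * u z) n r = c * circleCoeff u n r := by
  simp only [circleCoeff, mul_assoc]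
  rw [intervalIntegral.integral_const_mul]
  ring

lemma continuousOn_circleCoeff {v : ℂ → ℂ} {S : Set ℂ} {T : Set ℝ} (hv : ContinuousOn v S)
    (hT : ∀ r ∈ T, ∀ θ : ℝ, circleMap 0 r θ ∈ S) (n : ℤ) : ContinuousOn (circleCoeff v n) T := by
  rw [continuousOn_iff_continuous_domRestrict]
  refine Continuous.mul continuous_const ?_
  refine intervalIntegral.continuous_parametric_intervalIntegral_of_continuous'
    (f := fun (r : T) (θ : ℝ) => v (circleMap 0 r θ) * Complex.exp (-(n * θ * Complex.I))) ?_ _ _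
  refine Continuous.mul ?_ ?_
  · exact hv.comp_continuous (by unfold circleMap; fun_prop) (fun x => hT _ x.1.2 _)
  · fun_prop

lemma hasDerivAt_radial {v : ℂ → ℂ} {r θ : ℝ} (hv : DifferentiableAt ℝ v (circleMap 0 r θ)) :
    HasDerivAt (fun x : ℝ => v (circleMap 0 x θ))
      (fderiv ℝ v (circleMap 0 r θ) (Complex.exp (θ * Complex.I))) r := by
  have h1 : HasDerivAt (fun x : ℝ => circleMap 0 x θ) (Complex.exp (θ * Complex.I)) r := by
    simp only [circleMap, zero_add]
    simpa using (Complex.ofRealCLM.hasDerivAt (x := r)).mul_const (Complex.exp (θ * Complex.I))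
  exact hv.hasFDerivAt.comp_hasDerivAt r h1

lemma hasDerivAt_angular {v : ℂ → ℂ} {r θ : ℝ} (hv : DifferentiableAt ℝ v (circleMap 0 r θ)) :
    HasDerivAt (fun x : ℝ => v (circleMap 0 r x))
      (fderiv ℝ v (circleMap 0 r θ) (circleMap 0 r θ * Complex.I)) θ :=
  hv.hasFDerivAt.comp_hasDerivAt θ (hasDerivAt_circleMap 0 r θ)

lemma hasDerivAt_exp_coeff (n : ℤ) (θ : ℝ) :
    HasDerivAt (fun x : ℝ => Complex.exp (-(n * x * Complex.I)))
      (-(n * Complex.I) * Complex.exp (-(n * θ * Complex.I))) θ := by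
  have h0 : HasDerivAt (fun x : ℝ => (-(n * x * Complex.I) : ℂ)) (-(n * Complex.I)) θ := by
    have := (((Complex.ofRealCLM.hasDerivAt (x := θ)).const_mul (n : ℂ)).mul_const
      Complex.I).fun_neg
    simpa using this
  simpa [mul_comm] using h0.cexp

lemma exp_coeff_two_pi (n : ℤ) :
    Complex.exp (-(n * ((2 * Real.pi : ℝ) : ℂ) * Complex.I)) = 1 := by
  have : (-(n * ((2 * Real.pi : ℝ) : ℂ) * Complex.I)) = ((-n : ℤ) : ℂ) * (2 * Real.pi * Complex.I) := by
    push_cast; ring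
  rw [this, Complex.exp_int_mul_two_pi_mul_I]

/-- Polar form of the radial derivative. -/
lemma fderiv_exp_eq {v : ℂ → ℂ} {r θ : ℝ} {s : ℤ} (hs : s = 1 ∨ s = -1) (hr : r ≠ 0) :
    fderiv ℝ v (circleMap 0 r θ) (Complex.exp (θ * Complex.I)) =
      dirD s v (circleMap 0 r θ) * Complex.exp (-(s * θ * Complex.I))
        - s * Complex.I / r * fderiv ℝ v (circleMap 0 r θ) (circleMap 0 r θ * Complex.I) := by
  set L := fderiv ℝ v (circleMap 0 r θ)
  have hL : ∀ z : ℂ, L z = z.re * L 1 + z.im * L Complex.I := by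
    intro z
    have h : z = z.re • (1 : ℂ) + z.im • Complex.I := by
      simp [Complex.re_add_im]
    conv_lhs => rw [h]
    rw [map_add, map_smul, map_smul]; simp
  have hE : Complex.exp (θ * Complex.I) = Real.cos θ + Real.sin θ * Complex.I := by
    rw [Complex.exp_mul_I]; push_cast; rfl
  have hE' : Complex.exp (-(s * θ * Complex.I)) = Real.cos θ - s * Real.sin θ * Complex.I := by
    rcases hs with rfl | rfl
    · rw [show (-(((1 : ℤ) : ℂ) * θ * Complex.I)) = ((-θ : ℝ) : ℂ) * Complex.I by push_cast; ring,
        Complex.exp_mul_I]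
      simp; ring
    · rw [show (-(((-1 : ℤ) : ℂ) * θ * Complex.I)) = (θ : ℂ) * Complex.I by push_cast; ring,
        Complex.exp_mul_I]
      simp
  have hs2 : (s : ℂ) * s = 1 := by rcases hs with rfl | rfl <;> simp
  have hr' : (r : ℂ) ≠ 0 := by exact_mod_cast hr
  have hD : dirD s v (circleMap 0 r θ) = L 1 + s * Complex.I * L Complex.I := rfl
  rw [hL (Complex.exp _), hL (circleMap 0 r θ * Complex.I), hE', hD]
  clear_value L
  have hre : (circleMap 0 r θ * Complex.I).re = -(r * Real.sin θ) := by
    simp [circleMap, hE, -Complex.ofReal_sin, -Complex.ofReal_cos]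
  have him : (circleMap 0 r θ * Complex.I).im = r * Real.cos θ := by
    simp [circleMap, hE, -Complex.ofReal_sin, -Complex.ofReal_cos]
  have hre' : (Complex.exp (θ * Complex.I)).re = Real.cos θ := Complex.exp_ofReal_mul_I_re θ
  have him' : (Complex.exp (θ * Complex.I)).im = Real.sin θ := Complex.exp_ofReal_mul_I_im θ
  rw [hre, him, hre', him']
  push_cast
  field_simp
  linear_combination (-(L Complex.I) * Complex.sin θ) * hs2
    + (L Complex.I * Complex.sin θ * s ^ 2) * Complex.I_sq

/-- The radial derivative is e^{-isθ}(∂_x + si∂_y) minus (si/r)∂_θ. The factor e^{-isθ} shifts the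
frequency to n + s, and integrating ∂_θ by parts against e^{-inθ} produces sn/r. Both signs of s are
available, so the sign of the singular term can be chosen. -/
theorem hasDerivAt_circleCoeff {v : ℂ → ℂ} (hv : ContDiffOn ℝ 1 v (ball 0 1)) {s : ℤ}
    (hs : s = 1 ∨ s = -1) (n : ℤ) {r : ℝ} (h0 : 0 < r) (h1 : r < 1) :
    HasDerivAt (circleCoeff v n)
      (circleCoeff (dirD s v) (n + s) r + (s * n : ℤ) / r * circleCoeff v n r) r := by
  have hopen : IsOpen (ball (0 : ℂ) 1) := isOpen_ball
  have hd : ∀ z ∈ ball (0 : ℂ) 1, DifferentiableAt ℝ v z := fun z hz =>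
    (hv.differentiableOn one_ne_zero).differentiableAt (hopen.mem_nhds hz)
  have hfd : ContinuousOn (fderiv ℝ v) (ball 0 1) := hv.continuousOn_fderiv_of_isOpen hopen le_rfl
  have hcm : ∀ x ∈ Ioo (-1 : ℝ) 1, ∀ θ : ℝ, circleMap 0 x θ ∈ ball (0 : ℂ) 1 := by
    intro x hx θ; simpa [abs_lt] using hx
  have hrm : r ∈ Ioo (-1 : ℝ) 1 := ⟨by linarith, h1⟩
  have hrc : Continuous fun θ : ℝ => v (circleMap 0 r θ) :=
    hv.continuousOn.comp_continuous (continuous_circleMap 0 r) (hcm r hrm)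
  have hfc : ∀ e : ℝ → ℂ, Continuous e →
      Continuous fun θ : ℝ => fderiv ℝ v (circleMap 0 r θ) (e θ) := fun e he =>
    (hfd.comp_continuous (continuous_circleMap 0 r) (hcm r hrm)).clm_apply he
  have hec : Continuous fun θ : ℝ => Complex.exp (-(n * θ * Complex.I)) := by fun_prop
  -- A compact disk containing a neighbourhood of the circle of radius r, on which the derivative is
  -- bounded, as domination requires.
  set ρ := (1 + r) / 2 with hρ
  have hρ1 : ρ < 1 := by rw [hρ]; linarith
  obtain ⟨B, hB⟩ : ∃ B, ∀ z ∈ closedBall (0 : ℂ) ρ, ‖fderiv ℝ v z‖ ≤ B :=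
    (isCompact_closedBall (0 : ℂ) ρ).exists_bound_of_continuousOn
      (hfd.mono (closedBall_subset_ball hρ1))
  have hnhds : Ioo (-ρ) ρ ∈ 𝓝 r := Ioo_mem_nhds (by linarith) (by rw [hρ]; linarith)
  have key := (intervalIntegral.hasDerivAt_integral_of_dominated_loc_of_deriv_le
    (μ := volume) (a := 0) (b := 2 * Real.pi) (bound := fun _ => B)
    (F := fun (x : ℝ) (θ : ℝ) => v (circleMap 0 x θ) * Complex.exp (-(n * θ * Complex.I)))
    (F' := fun (x : ℝ) (θ : ℝ) => fderiv ℝ v (circleMap 0 x θ) (Complex.exp (θ * Complex.I))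
      * Complex.exp (-(n * θ * Complex.I))) (x₀ := r) hnhds ?_ ?_ ?_ ?_ ?_ ?_).2
  rotate_left
  · filter_upwards [Ioo_mem_nhds hrm.1 hrm.2] with x hx
    exact ((hv.continuousOn.comp_continuous (continuous_circleMap 0 x)
      (hcm x hx)).mul hec).aestronglyMeasurable
  · exact (hrc.mul hec).intervalIntegrable _ _
  · exact ((hfc _ (by fun_prop)).mul hec).aestronglyMeasurable
  · refine ae_of_all _ fun θ _ x hx => ?_
    rw [norm_mul, norm_exp_coeff, mul_one]
    refine (ContinuousLinearMap.le_opNorm _ _).trans ?_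
    rw [Complex.norm_exp_ofReal_mul_I, mul_one]
    refine hB _ ?_
    have : |x| < ρ := abs_lt.2 hx
    simpa using this.le
  · exact intervalIntegrable_const
  · refine ae_of_all _ fun θ _ x hx => ?_
    exact (hasDerivAt_radial (hd _ (hcm x ⟨by linarith [hx.1], by linarith [hx.2]⟩ θ))).mul_const _
  have hibp := intervalIntegral.integral_deriv_mul_eq_sub (a := 0) (b := 2 * Real.pi)
    (fun θ _ => hasDerivAt_angular (hd _ (hcm r hrm θ)))
    (fun θ _ => hasDerivAt_exp_coeff n θ)
    ((hfc _ (by fun_prop)).intervalIntegrable _ _)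
    ((continuous_const.mul hec).intervalIntegrable _ _)
  have hper : circleMap 0 r (2 * Real.pi) = circleMap 0 r 0 := by
    simpa using periodic_circleMap 0 r 0
  rw [exp_coeff_two_pi, hper, intervalIntegral.integral_add] at hibp
  rotate_left
  · exact ((hfc _ (by fun_prop)).mul hec).intervalIntegrable _ _
  · exact (hrc.mul (continuous_const.mul hec)).intervalIntegrable _ _
  have hibp2 : ∫ θ in (0 : ℝ)..2 * Real.pi,
      fderiv ℝ v (circleMap 0 r θ) (circleMap 0 r θ * Complex.I)
        * Complex.exp (-(n * θ * Complex.I)) =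
      n * Complex.I * ∫ θ in (0 : ℝ)..2 * Real.pi,
        v (circleMap 0 r θ) * Complex.exp (-(n * θ * Complex.I)) := by
    have : ∫ θ in (0 : ℝ)..2 * Real.pi, v (circleMap 0 r θ) *
        (-(n * Complex.I) * Complex.exp (-(n * θ * Complex.I))) =
        -(n * Complex.I) * ∫ θ in (0 : ℝ)..2 * Real.pi,
        v (circleMap 0 r θ) * Complex.exp (-(n * θ * Complex.I)) := by
      rw [← intervalIntegral.integral_const_mul]
      congr 1; ext θ; ring
    rw [this] at hibp
    simp only [Complex.ofReal_zero, mul_zero, zero_mul, neg_zero, Complex.exp_zero, sub_self] at hibp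
    linear_combination hibp
  have hsplit : ∫ θ in (0 : ℝ)..2 * Real.pi,
      fderiv ℝ v (circleMap 0 r θ) (Complex.exp (θ * Complex.I))
        * Complex.exp (-(n * θ * Complex.I)) =
      (∫ θ in (0 : ℝ)..2 * Real.pi, dirD s v (circleMap 0 r θ)
        * Complex.exp (-((n + s : ℤ) * θ * Complex.I))) -
      s * Complex.I / r * ∫ θ in (0 : ℝ)..2 * Real.pi,
        fderiv ℝ v (circleMap 0 r θ) (circleMap 0 r θ * Complex.I)
        * Complex.exp (-(n * θ * Complex.I)) := by
    rw [← intervalIntegral.integral_const_mul, ← intervalIntegral.integral_sub]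
    · congr 1; ext θ
      rw [fderiv_exp_eq hs h0.ne']
      have : Complex.exp (-((n + s : ℤ) * θ * Complex.I)) =
          Complex.exp (-(s * θ * Complex.I)) * Complex.exp (-(n * θ * Complex.I)) := by
        rw [← Complex.exp_add]; push_cast; congr 1; ring
      rw [this]; ring
    · have h1 : Continuous fun θ : ℝ => fderiv ℝ v (circleMap 0 r θ) 1 := hfc _ continuous_const
      have h2 : Continuous fun θ : ℝ => fderiv ℝ v (circleMap 0 r θ) Complex.I :=
        hfc _ continuous_const
      refine Continuous.intervalIntegrable ?_ _ _
      unfold dirD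
      fun_prop
    · exact (continuous_const.mul ((hfc _ (by fun_prop)).mul hec)).intervalIntegrable _ _
  have hfin := key.const_mul (2 * Real.pi : ℂ)⁻¹
  refine hfin.congr_deriv ?_
  rw [hsplit, hibp2]
  unfold circleCoeff
  push_cast
  linear_combination (-(2 * Real.pi : ℂ)⁻¹ * s * n / r * ∫ θ in (0 : ℝ)..2 * Real.pi,
        v (circleMap 0 r θ) * Complex.exp (-(n * θ * Complex.I))) * Complex.I_sq

/-- Fourier coefficients of a function with continuous boundary values. -/
lemma tendsto_circleCoeff_one {u ψ : ℂ → ℂ} (hu : ContinuousOn u (ball 0 1))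
    (h : ∀ ζ ∈ sphere (0 : ℂ) 1, Tendsto u (𝓝[ball 0 1] ζ) (𝓝 (ψ ζ))) (n : ℤ) :
    Tendsto (circleCoeff u n) (𝓝[<] 1) (𝓝 (circleCoeff ψ n 1)) := by
  -- The continuous extension to the closed disk makes the coefficients continuous in the radius up
  -- to 1.
  set U := extendFrom (ball (0 : ℂ) 1) u with hU
  have hcl : closure (ball (0 : ℂ) 1) = closedBall 0 1 := closure_ball 0 one_ne_zero
  have hin : ∀ z ∈ ball (0 : ℂ) 1, U z = u z := fun z hz =>
    extendFrom_eq (subset_closure hz) (hu z hz)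
  have hbd : ∀ z ∈ sphere (0 : ℂ) 1, U z = ψ z := fun z hz =>
    extendFrom_eq (by rw [hcl]; exact sphere_subset_closedBall hz) (h z hz)
  have hc : ContinuousOn U (closedBall 0 1) := by
    refine continuousOn_extendFrom hcl.ge fun z hz => ?_
    rcases (mem_closedBall.1 hz).lt_or_eq with h' | h'
    · exact ⟨_, hu z h'⟩
    · exact ⟨_, h z h'⟩
  have hcc : ContinuousOn (circleCoeff U n) (Icc 0 1) :=
    continuousOn_circleCoeff hc (fun r hr θ => by simpa [abs_of_nonneg hr.1] using hr.2) n
  have h1 := (hcc 1 (by simp)).mono_left (nhdsWithin_mono _ (Ioo_subset_Icc_self (a := (0 : ℝ))))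
  rw [nhdsWithin_Ioo_eq_nhdsLT (zero_lt_one)] at h1
  rw [circleCoeff_congr (u := U) (v := ψ) (r := 1) (fun θ => hbd _ (by simp))] at h1
  refine h1.congr' ?_
  filter_upwards [Ioo_mem_nhdsLT (zero_lt_one : (0 : ℝ) < 1)] with r hr
  exact circleCoeff_congr (fun θ => hin _ (circleMap_mem_unit_ball hr.1.le hr.2 θ)) n

/-! ### First-order radial equations and the biharmonic system -/

lemma norm_sub_le_of_norm_deriv_le {f f' : ℝ → ℂ} {B B' : ℝ → ℝ} {a b : ℝ} (hab : a ≤ b)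
    (hf : ∀ t ∈ Icc a b, HasDerivAt f (f' t) t) (hB : ∀ t, HasDerivAt B (B' t) t)
    (h : ∀ t ∈ Icc a b, ‖f' t‖ ≤ B' t) : ‖f b - f a‖ ≤ B b - B a := by
  refine image_norm_le_of_norm_deriv_right_le_deriv_boundary (a := a) (b := b)
    (f := fun t => f t - f a) (B := fun t => B t - B a) (f' := f') (B' := B') ?_ ?_ ?_ ?_ ?_
    (right_mem_Icc.2 hab)
  · exact fun t ht => ((hf t ht).continuousAt.sub continuousAt_const).continuousWithinAt
  · exact fun t ht => ((hf t (Ico_subset_Icc_self ht)).sub_const _).hasDerivWithinAt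
  · simp
  · exact fun t => (hB t).sub_const _
  · exact fun t ht => h t (Ico_subset_Icc_self ht)

/-- Solutions of `b' = w - (m + 1) / r * b` that are bounded at the origin. -/
lemma norm_le_of_deriv_regular {b w : ℝ → ℂ} {m : ℕ} {K : ℝ} (hK : 0 ≤ K)
    (hc : ContinuousWithinAt b (Ioi 0) 0)
    (hb : ∀ r ∈ Ioo (0 : ℝ) 1, HasDerivAt b (w r - (m + 1) / r * b r) r)
    (hw : ∀ r ∈ Ioo (0 : ℝ) 1, ‖w r‖ ≤ K) {r : ℝ} (hr : r ∈ Ioo (0 : ℝ) 1) :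
    ‖b r‖ ≤ K / (m + 2) := by
  have hm : (0 : ℝ) < m + 2 := by positivity
  -- Integrating factor t^{m+1}. Continuity of b at 0 makes the contribution of the lower endpoint ε
  -- vanish, which excludes the homogeneous solution t^{-(m+1)}.
  have hder : ∀ t ∈ Ioo (0 : ℝ) 1,
      HasDerivAt (fun t : ℝ => (t : ℂ) ^ (m + 1) * b t) ((t : ℂ) ^ (m + 1) * w t) t := by
    intro t ht
    have ht0 : (t : ℂ) ≠ 0 := by exact_mod_cast ht.1.ne'
    have h1 : HasDerivAt (fun t : ℝ => (t : ℂ) ^ (m + 1)) ((m + 1) * (t : ℂ) ^ m) t := by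
      simpa using (Complex.ofRealCLM.hasDerivAt (x := t)).fun_pow (m + 1)
    refine (h1.mul (hb t ht)).congr_deriv ?_
    field_simp
    ring
  have hB : ∀ t : ℝ, HasDerivAt (fun t : ℝ => K / (m + 2) * t ^ (m + 2)) (K * t ^ (m + 1)) t := by
    intro t
    have := (hasDerivAt_pow (m + 2) t).const_mul (K / (m + 2))
    refine this.congr_deriv ?_
    push_cast
    field_simp
  have hle : ∀ ε ∈ Ioo (0 : ℝ) r,
      ‖(r : ℂ) ^ (m + 1) * b r‖ ≤ ‖(ε : ℂ) ^ (m + 1) * b ε‖ + K / (m + 2) * r ^ (m + 2) := by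
    intro ε hε
    have hsub : ∀ t ∈ Icc ε r, t ∈ Ioo (0 : ℝ) 1 := fun t ht =>
      ⟨hε.1.trans_le ht.1, ht.2.trans_lt hr.2⟩
    have := norm_sub_le_of_norm_deriv_le hε.2.le (fun t ht => hder t (hsub t ht)) hB
      (fun t ht => by
        have h0 := (hsub t ht).1
        rw [norm_mul, norm_pow, Complex.norm_real, Real.norm_eq_abs, abs_of_pos h0, mul_comm]
        exact mul_le_mul_of_nonneg_right (hw t (hsub t ht)) (by positivity))
    have h2 := norm_sub_norm_le ((r : ℂ) ^ (m + 1) * b r) ((ε : ℂ) ^ (m + 1) * b ε)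
    have h3 : 0 ≤ K / (m + 2) * ε ^ (m + 2) := by have := hε.1; positivity
    linarith
  have hlim : Tendsto (fun ε : ℝ => ‖(ε : ℂ) ^ (m + 1) * b ε‖ + K / (m + 2) * r ^ (m + 2))
      (𝓝[>] 0) (𝓝 (0 + K / (m + 2) * r ^ (m + 2))) := by
    refine Tendsto.add_const _ ?_
    have h1 : Tendsto (fun ε : ℝ => (ε : ℂ) ^ (m + 1)) (𝓝[>] 0) (𝓝 0) := by
      have : Continuous fun ε : ℝ => (ε : ℂ) ^ (m + 1) := by fun_prop
      simpa using (this.tendsto 0).mono_left nhdsWithin_le_nhds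
    have := (h1.mul hc).norm
    simpa using this
  have hge := ge_of_tendsto hlim (by
    filter_upwards [Ioo_mem_nhdsGT hr.1] with ε hε using hle ε hε)
  rw [norm_mul, norm_pow, Complex.norm_real, Real.norm_eq_abs, abs_of_pos hr.1, zero_add] at hge
  have hp : 0 < r ^ (m + 1) := pow_pos hr.1 _
  have : r ^ (m + 1) * ‖b r‖ ≤ r ^ (m + 1) * (K / (m + 2) * r) := by
    calc _ ≤ _ := hge
      _ = _ := by ring
  have h4 := le_of_mul_le_mul_left this hp
  refine h4.trans ?_
  have : 0 ≤ K / (m + 2) := by positivity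
  nlinarith [hr.2]

lemma hasDerivAt_inv_pow_mul {w d : ℝ → ℂ} {m : ℕ} {t : ℝ} (ht : 0 < t)
    (hw : HasDerivAt w (d t + m / t * w t) t) :
    HasDerivAt (fun t : ℝ => ((t : ℂ) ^ m)⁻¹ * w t) (((t : ℂ) ^ m)⁻¹ * d t) t := by
  have ht0 : (t : ℂ) ≠ 0 := by exact_mod_cast ht.ne'
  have h1 : HasDerivAt (fun t : ℝ => ((t : ℂ) ^ m)⁻¹) (-(m * (t : ℂ) ^ (m - 1)) / ((t : ℂ) ^ m) ^ 2) t := by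
    have := (Complex.ofRealCLM.hasDerivAt (x := t)).fun_pow m
    simpa using this.fun_inv (by simp [ht0])
  refine (h1.mul hw).congr_deriv ?_
  rcases m with _ | m
  · simp
  · field_simp
    push_cast
    ring

/-- Two-point estimate for solutions of `w' = d + m / r * w`. -/
lemma norm_sub_le_of_deriv_growth {w d : ℝ → ℂ} {m : ℕ} {K r s : ℝ} (hr : 0 < r) (hrs : r ≤ s)
    (hw : ∀ t ∈ Icc r s, HasDerivAt w (d t + m / t * w t) t)
    (hd : ∀ t ∈ Icc r s, ‖d t‖ ≤ K) :
    ‖((s : ℂ) ^ m)⁻¹ * w s - ((r : ℂ) ^ m)⁻¹ * w r‖ ≤ (r ^ m)⁻¹ * K * (s - r) := by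
  have := norm_sub_le_of_norm_deriv_le (B := fun t => (r ^ m)⁻¹ * K * t)
    (B' := fun _ => (r ^ m)⁻¹ * K) hrs
    (fun t ht => hasDerivAt_inv_pow_mul (hr.trans_le ht.1) (hw t ht))
    (fun t => by simpa using (hasDerivAt_id t).const_mul ((r ^ m)⁻¹ * K))
    (fun t ht => by
      have ht0 : 0 < t := hr.trans_le ht.1
      rw [norm_mul, norm_inv, norm_pow, Complex.norm_real, Real.norm_eq_abs, abs_of_pos ht0]
      have := hd t ht
      have h2 := ht.1
      gcongr)
  linarith [this]

/-- Let s tend to 1 in the two-point estimate: the factor r^{-m} then occurs on both sides and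
cancels, so the constant does not depend on m. -/
lemma norm_le_of_deriv_growth_of_tendsto_zero {w d : ℝ → ℂ} {m : ℕ} {K r : ℝ}
    (hr : r ∈ Ioo (0 : ℝ) 1) (hw : ∀ t ∈ Ioo (0 : ℝ) 1, HasDerivAt w (d t + m / t * w t) t)
    (hd : ∀ t ∈ Ico r 1, ‖d t‖ ≤ K) (h0 : Tendsto w (𝓝[<] 1) (𝓝 0)) :
    ‖w r‖ ≤ K * (1 - r) := by
  have h1 : Tendsto (fun s : ℝ => ((s : ℂ) ^ m)⁻¹) (𝓝[<] 1) (𝓝 1) := by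
    have : ContinuousAt (fun s : ℝ => ((s : ℂ) ^ m)⁻¹) 1 := by
      refine ContinuousAt.inv₀ (by fun_prop) (by simp)
    simpa [ContinuousAt] using this.tendsto.mono_left (nhdsWithin_le_nhds (s := Iio 1))
  have h2 := ((h1.mul h0).sub_const (((r : ℂ) ^ m)⁻¹ * w r)).norm
  have h3 : Tendsto (fun s : ℝ => (r ^ m)⁻¹ * K * (s - r)) (𝓝[<] 1) (𝓝 ((r ^ m)⁻¹ * K * (1 - r))) := by
    have : Continuous fun s : ℝ => (r ^ m)⁻¹ * K * (s - r) := by fun_prop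
    exact (this.tendsto 1).mono_left nhdsWithin_le_nhds
  have h4 := le_of_tendsto_of_tendsto h2 h3 (by
    filter_upwards [Ioo_mem_nhdsLT hr.2] with s hs
    exact norm_sub_le_of_deriv_growth hr.1 hs.1.le
      (fun t ht => hw t ⟨hr.1.trans_le ht.1, ht.2.trans_lt hs.2⟩)
      (fun t ht => hd t ⟨ht.1, ht.2.trans_lt hs.2⟩))
  have hp : 0 < (r ^ m)⁻¹ := inv_pos.2 (pow_pos hr.1 _)
  rw [mul_zero, zero_sub, norm_neg, norm_mul, norm_inv, norm_pow, Complex.norm_real,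
    Real.norm_eq_abs, abs_of_pos hr.1, mul_assoc] at h4
  exact le_of_mul_le_mul_left h4 hp

/-- The function r^{-m} w is Lipschitz near 1 and so has a limit C there. Subtracting the
homogeneous solution C r^m leaves a solution that vanishes at 1. -/
lemma exists_norm_sub_le_of_deriv_growth {w d : ℝ → ℂ} {m : ℕ} {K : ℝ}
    (hw : ∀ t ∈ Ioo (0 : ℝ) 1, HasDerivAt w (d t + m / t * w t) t)
    (hd : ∀ t ∈ Ioo (0 : ℝ) 1, ‖d t‖ ≤ K) :
    ∃ C : ℂ, ∀ r ∈ Ioo (0 : ℝ) 1, ‖w r - C * (r : ℂ) ^ m‖ ≤ K * (1 - r) := by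
  have hK : 0 ≤ K := (norm_nonneg _).trans (hd (1 / 2) (by norm_num))
  set q : ℝ → ℂ := fun t => ((t : ℂ) ^ m)⁻¹ * w t with hq
  -- Staying above 1/2 keeps t^{-m} bounded; the constant depends on m, but only the existence of
  -- the limit is needed from it.
  have hlip : LipschitzOnWith (Real.toNNReal (((1 / 2 : ℝ) ^ m)⁻¹ * K)) q (Ico (1 / 2) 1) := by
    have key : ∀ r ∈ Ico (1 / 2 : ℝ) 1, ∀ s ∈ Ico (1 / 2 : ℝ) 1, r ≤ s →
        dist (q s) (q r) ≤ ((1 / 2 : ℝ) ^ m)⁻¹ * K * dist s r := by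
      intro r hr s hs hrs
      have hr0 : (0 : ℝ) < r := by linarith [hr.1]
      rw [dist_eq_norm, Real.dist_eq, abs_of_nonneg (sub_nonneg.2 hrs)]
      refine (norm_sub_le_of_deriv_growth hr0 hrs
        (fun t ht => hw t ⟨hr0.trans_le ht.1, ht.2.trans_lt hs.2⟩)
        (fun t ht => hd t ⟨hr0.trans_le ht.1, ht.2.trans_lt hs.2⟩)).trans ?_
      have := hr.1
      have := sub_nonneg.2 hrs
      gcongr
    refine LipschitzOnWith.of_dist_le_mul fun x hx y hy => ?_
    rw [Real.coe_toNNReal _ (by positivity)]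
    rcases le_total x y with h | h
    · rw [dist_comm, dist_comm x]; exact key x hx y hy h
    · exact key y hy x hx h
  obtain ⟨Q, hQ, hQe⟩ := hlip.extend_finite_dimension
  refine ⟨Q 1, fun r hr => ?_⟩
  have hqlim : Tendsto q (𝓝[<] 1) (𝓝 (Q 1)) := by
    refine ((hQ.continuous.tendsto 1).mono_left nhdsWithin_le_nhds).congr' ?_
    filter_upwards [Ico_mem_nhdsLT (show (1 / 2 : ℝ) < 1 by norm_num)] with t ht using (hQe ht).symm
  refine norm_le_of_deriv_growth_of_tendsto_zero (w := fun r => w r - Q 1 * (r : ℂ) ^ m) (d := d)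
    (m := m) hr ?_ (fun t ht => hd t ⟨hr.1.trans_le ht.1, ht.2⟩) ?_
  · intro t ht
    have ht0 : (t : ℂ) ≠ 0 := by exact_mod_cast ht.1.ne'
    have h1 : HasDerivAt (fun t : ℝ => (t : ℂ) ^ m) (m * (t : ℂ) ^ (m - 1)) t := by
      simpa using (Complex.ofRealCLM.hasDerivAt (x := t)).fun_pow m
    refine ((hw t ht).fun_sub (h1.const_mul (Q 1))).congr_deriv ?_
    rcases m with _ | m
    · simp
    · field_simp
      simp
      ring
  · have h1 : Tendsto (fun s : ℝ => (s : ℂ) ^ m) (𝓝[<] 1) (𝓝 1) := by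
      have : Continuous (fun s : ℝ => (s : ℂ) ^ m) := by fun_prop
      simpa using (this.tendsto 1).mono_left (nhdsWithin_le_nhds (s := Iio 1))
    have h2 := (hqlim.sub_const (Q 1)).mul h1
    rw [sub_self, zero_mul] at h2
    refine h2.congr' ?_
    filter_upwards [Ioo_mem_nhdsLT (zero_lt_one : (0 : ℝ) < 1)] with t ht
    have ht0 : (t : ℂ) ≠ 0 := by exact_mod_cast ht.1.ne'
    simp only [hq]
    field_simp

/-- Boundary behaviour of one Fourier mode of a solution of the biharmonic equation, written as a
first-order system. -/
theorem radial_biharmonic_estimate {a b w d γ : ℝ → ℂ} {m : ℕ} {M : ℝ} {c : ℂ} (hM : 0 ≤ M)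
    (ha : ∀ r ∈ Ioo (0 : ℝ) 1, HasDerivAt a (b r + m / r * a r) r)
    (hb : ∀ r ∈ Ioo (0 : ℝ) 1, HasDerivAt b (w r - (m + 1) / r * b r) r)
    (hw : ∀ r ∈ Ioo (0 : ℝ) 1, HasDerivAt w (d r + m / r * w r) r)
    (hd : ∀ r ∈ Ioo (0 : ℝ) 1, HasDerivAt d (γ r - (m + 1) / r * d r) r)
    (hγ : ∀ r ∈ Ioo (0 : ℝ) 1, ‖γ r‖ ≤ M)
    (hb0 : ContinuousWithinAt b (Ioi 0) 0) (hd0 : ContinuousWithinAt d (Ioi 0) 0)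
    (ha1 : Tendsto a (𝓝[<] 1) (𝓝 0)) (hb1 : Tendsto b (𝓝[<] 1) (𝓝 (2 * c))) :
    (∀ r ∈ Ioo (0 : ℝ) 1,
      ‖a r + c * (1 - (r : ℂ) ^ 2) * (r : ℂ) ^ m‖ ≤ 2 * (M / (m + 2) ^ 2) * (1 - r)) ∧
    Tendsto (fun r : ℝ => (a r + c * (1 - (r : ℂ) ^ 2) * (r : ℂ) ^ m) / (1 - r : ℝ))
      (𝓝[<] 1) (𝓝 0) := by
  have hm2 : (0 : ℝ) < m + 2 := by positivity
  have hmc : (2 * m + 2 : ℂ) ≠ 0 := by exact_mod_cast (show (2 * m + 2 : ℕ) ≠ 0 by omega)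
  have hdb : ∀ r ∈ Ioo (0 : ℝ) 1, ‖d r‖ ≤ M / (m + 2) := fun r hr =>
    norm_le_of_deriv_regular hM hd0 hd hγ hr
  obtain ⟨C, hC⟩ := exists_norm_sub_le_of_deriv_growth hw hdb
  have hpow : ∀ (k : ℕ) (t : ℝ), HasDerivAt (fun t : ℝ => (t : ℂ) ^ k) (k * (t : ℂ) ^ (k - 1)) t := by
    intro k t
    simpa using (Complex.ofRealCLM.hasDerivAt (x := t)).fun_pow k
  have hpow1 : ∀ k : ℕ, Tendsto (fun s : ℝ => (s : ℂ) ^ k) (𝓝[<] 1) (𝓝 1) := by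
    intro k
    have : Continuous (fun s : ℝ => (s : ℂ) ^ k) := by fun_prop
    simpa using (this.tendsto 1).mono_left (nhdsWithin_le_nhds (s := Iio 1))
  -- The subtracted term is the particular solution for the forcing C r^m. The unknown C thus leaves
  -- the bound for b', which is uniform in C and c.
  set b' : ℝ → ℂ := fun r => b r - C / (2 * m + 2) * (r : ℂ) ^ (m + 1) with hb'
  set e : ℂ := 2 * c - C / (2 * m + 2) with he
  set K := M / (m + 2) ^ 2 with hKdef
  have hK : 0 ≤ K := by positivity
  have hbb : ∀ r ∈ Ioo (0 : ℝ) 1, ‖b' r‖ ≤ K := by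
    intro r hr
    have := norm_le_of_deriv_regular (b := b') (w := fun r => w r - C * (r : ℂ) ^ m) (m := m)
      (K := M / (m + 2)) (by positivity) ?_ ?_ ?_ hr
    · refine this.trans_eq ?_
      rw [hKdef]; field_simp
    · refine hb0.sub (Continuous.continuousWithinAt ?_)
      fun_prop
    · intro t ht
      have ht0 : (t : ℂ) ≠ 0 := by exact_mod_cast ht.1.ne'
      refine ((hb t ht).fun_sub ((hpow (m + 1) t).const_mul (C / (2 * m + 2)))).congr_deriv ?_
      simp only [hb']
      push_cast
      field_simp
      ring
    · intro t ht
      refine (hC t ht).trans ?_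
      have : 0 ≤ M / (m + 2) := by positivity
      nlinarith [ht.1]
  have hb'1 : Tendsto b' (𝓝[<] 1) (𝓝 e) := by
    have := hb1.sub ((hpow1 (m + 1)).const_mul (C / (2 * m + 2)))
    simpa [he] using this
  have heK : ‖e‖ ≤ K := le_of_tendsto hb'1.norm (by
    filter_upwards [Ioo_mem_nhdsLT (zero_lt_one : (0 : ℝ) < 1)] with r hr using hbb r hr)
  -- By the choice of e this is b - 2c r^{m+1}. Writing it through b' and e gives the bound 2K,
  -- because e is a limit of values of b'.
  set β : ℝ → ℂ := fun r => b' r - e * (r : ℂ) ^ (m + 1) with hβ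
  have hβ1 : Tendsto β (𝓝[<] 1) (𝓝 0) := by
    have := hb'1.sub ((hpow1 (m + 1)).const_mul e)
    simpa using this
  have hββ : ∀ r ∈ Ioo (0 : ℝ) 1, ‖β r‖ ≤ 2 * K := by
    intro r hr
    refine (norm_sub_le _ _).trans ?_
    rw [norm_mul, norm_pow, Complex.norm_real, Real.norm_eq_abs, abs_of_pos hr.1]
    have h1 : r ^ (m + 1) ≤ 1 := pow_le_one₀ hr.1.le hr.2.le
    have := hbb r hr
    have h3 : ‖e‖ * r ^ (m + 1) ≤ K * 1 := mul_le_mul heK h1 (pow_nonneg hr.1.le _) hK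
    linarith
  -- Since -c(1 - r²)r^m solves the equation for a with forcing 2c r^{m+1}, the forcing left for a'
  -- is β.
  set a' : ℝ → ℂ := fun r => a r + c * (1 - (r : ℂ) ^ 2) * (r : ℂ) ^ m with ha'
  have ha'd : ∀ t ∈ Ioo (0 : ℝ) 1, HasDerivAt a' (β t + m / t * a' t) t := by
    intro t ht
    have ht0 : (t : ℂ) ≠ 0 := by exact_mod_cast ht.1.ne'
    have h1 := (((hpow 2 t).const_sub 1).const_mul c).mul (hpow m t)
    refine ((ha t ht).fun_add h1).congr_deriv ?_
    simp only [hβ, hb', he, ha']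
    rcases m with _ | m
    · simp
      field_simp
      ring
    · simp only [Nat.add_sub_cancel]
      field_simp
      simp
      ring
  have ha'1 : Tendsto a' (𝓝[<] 1) (𝓝 0) := by
    have := ha1.add ((((hpow1 2).const_sub 1).const_mul c).mul (hpow1 m))
    simpa using this
  refine ⟨fun r hr => norm_le_of_deriv_growth_of_tendsto_zero hr ha'd
    (fun t ht => hββ t ⟨hr.1.trans_le ht.1, ht.2⟩) ha'1, ?_⟩
  -- For the o(1 - r) statement the same estimate is repeated near 1, where β is as small as
  -- desired.
  rw [Metric.tendsto_nhds]
  intro ε hε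
  have hev : ∀ᶠ r in 𝓝[<] (1 : ℝ), ‖β r‖ < ε / 2 := by
    have := Metric.tendsto_nhds.1 hβ1 (ε / 2) (half_pos hε)
    simpa using this
  obtain ⟨l, hl, hl'⟩ := (mem_nhdsLT_iff_exists_Ioo_subset' (zero_lt_one : (0 : ℝ) < 1)).1 hev
  filter_upwards [Ioo_mem_nhdsLT (max_lt hl zero_lt_one)] with r hr
  have hr0 : r ∈ Ioo (0 : ℝ) 1 := ⟨(le_max_right _ _).trans_lt hr.1, hr.2⟩
  have h1 := norm_le_of_deriv_growth_of_tendsto_zero (K := ε / 2) hr0 ha'd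
    (fun t ht => (hl' ⟨((le_max_left _ _).trans_lt hr.1).trans_le ht.1, ht.2⟩ : ‖β t‖ < ε / 2).le)
    ha'1
  have hpos : 0 < 1 - r := sub_pos.2 hr.2
  rw [dist_zero_right, norm_div, Complex.norm_real, Real.norm_eq_abs, abs_of_pos hpos,
    div_lt_iff₀ hpos]
  refine h1.trans_lt ?_
  exact mul_lt_mul_of_pos_right (half_lt_self hε) hpos

/-! ### Fourier series: the Poisson integral and inversion on circles -/

lemma hasSum_of_forall_eq {ι : Type*} {f g : ι → ℂ} {a : ℂ} (hf : HasSum f a)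
    (h : ∀ n, f n = g n) : HasSum g a := funext h ▸ hf

lemma summable_pow_natAbs {r : ℝ} (h0 : 0 ≤ r) (h1 : r < 1) :
    Summable fun n : ℤ => r ^ n.natAbs := by
  have h := summable_geometric_of_lt_one h0 h1
  refine Summable.of_nat_of_neg_add_one (by simpa using h) ?_
  have h2 := (summable_nat_add_iff 1).2 h
  exact h2.congr fun n => by congr 1

/-- With q = r e^{i(θ-t)} the kernel equals 1/(1 - q) + q̄/(1 - q̄): two geometric series, one for n
≥ 0 and one for n < 0. -/
lemma hasSum_poissonKernel {r : ℝ} (h0 : 0 ≤ r) (h1 : r < 1) (θ t : ℝ) :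
    HasSum (fun n : ℤ => (r : ℂ) ^ n.natAbs * Complex.exp (n * θ * Complex.I)
        * Complex.exp (-(n * t * Complex.I)))
      (poissonKernel 0 (circleMap 0 r θ) (circleMap 0 1 t) : ℂ) := by
  set p : ℂ := Complex.exp (((θ - t : ℝ) : ℂ) * Complex.I) with hp
  set q : ℂ := r * p with hq
  have hpn : ‖p‖ = 1 := Complex.norm_exp_ofReal_mul_I _
  have hcp : conj p = p⁻¹ := (Complex.inv_eq_conj hpn).symm
  have hp0 : p ≠ 0 := Complex.exp_ne_zero _
  have hqn : ‖q‖ < 1 := by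
    rw [hq, norm_mul, hpn, Complex.norm_real, Real.norm_eq_abs, abs_of_nonneg h0]; simpa using h1
  have hterm : ∀ n : ℤ, (r : ℂ) ^ n.natAbs * Complex.exp (n * θ * Complex.I)
        * Complex.exp (-(n * t * Complex.I)) = (r : ℂ) ^ n.natAbs * p ^ n := by
    intro n
    rw [mul_assoc, ← Complex.exp_add, hp, ← Complex.exp_int_mul]
    congr 2; push_cast; ring
  simp_rw [hterm]
  have hq' : ‖conj q‖ < 1 := by rwa [Complex.norm_conj]
  have hs1 := hasSum_geometric_of_norm_lt_one hqn
  have hs2 := (hasSum_geometric_of_norm_lt_one hq').mul_left (conj q)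
  have hne : 1 - q ≠ 0 := fun h => by
    rw [← sub_eq_zero.1 h, norm_one] at hqn; exact lt_irrefl _ hqn
  have hne' : 1 - conj q ≠ 0 := fun h => by
    rw [← sub_eq_zero.1 h, norm_one] at hq'; exact lt_irrefl _ hq'
  have hval : (poissonKernel 0 (circleMap 0 r θ) (circleMap 0 1 t) : ℂ) =
      (1 - q)⁻¹ + conj q * (1 - conj q)⁻¹ := by
    have hfac : circleMap 0 1 t - circleMap 0 r θ = Complex.exp (t * Complex.I) * (1 - q) := by
      simp only [circleMap, hq, hp, zero_add, mul_sub, Complex.ofReal_one, one_mul, mul_one]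
      rw [mul_left_comm, ← Complex.exp_add]
      congr 3; push_cast; ring
    have hqq : conj q * q = (r : ℂ) ^ 2 := by
      rw [hq, map_mul, hcp, Complex.conj_ofReal]; field_simp
    have hnorm : ((‖1 - q‖ : ℂ)) ^ 2 = (1 - q) * (1 - conj q) := by
      rw [← Complex.conj_mul']; simp; ring
    rw [poissonKernel_def, sub_zero, sub_zero, hfac, norm_mul, Complex.norm_exp_ofReal_mul_I,
      one_mul, norm_circleMap_zero, norm_circleMap_zero, abs_of_nonneg h0]
    push_cast
    rw [hnorm]
    field_simp
    simp only [abs_one, Complex.ofReal_one]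
    linear_combination hqq
  rw [hval]
  refine HasSum.of_nat_of_neg_add_one ?_ ?_
  · refine hasSum_of_forall_eq hs1 fun n => ?_
    simp [hq, mul_pow]
  · refine hasSum_of_forall_eq hs2 fun n => ?_
    have : (-((n : ℤ) + 1)).natAbs = n + 1 := by omega
    rw [this, ← pow_succ', hq, map_mul, hcp, Complex.conj_ofReal, mul_pow]
    congr 1
    rw [zpow_neg, inv_pow]
    norm_cast

/-- The Poisson integral as a Fourier series. -/
theorem hasSum_poissonIntegral {u : ℂ → ℂ} (hu : ContinuousOn u (sphere 0 1)) {r : ℝ}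
    (h0 : 0 ≤ r) (h1 : r < 1) (θ : ℝ) :
    HasSum (fun n : ℤ => circleCoeff u n 1 * (r : ℂ) ^ n.natAbs * Complex.exp (n * θ * Complex.I))
      (poissonIntegral u (circleMap 0 r θ)) := by
  obtain ⟨B, hB⟩ := (isCompact_sphere (0 : ℂ) 1).exists_bound_of_continuousOn hu
  have huc : Continuous fun t : ℝ => u (circleMap 0 1 t) :=
    hu.comp_continuous (continuous_circleMap 0 1) (fun t => by simp)
  have hB' : ∀ t : ℝ, ‖u (circleMap 0 1 t)‖ ≤ B := fun t => hB _ (by simp)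
  have key := intervalIntegral.hasSum_integral_of_dominated_convergence (μ := volume) (a := 0)
    (b := 2 * Real.pi)
    (F := fun (n : ℤ) (t : ℝ) => (r : ℂ) ^ n.natAbs * Complex.exp (n * θ * Complex.I)
        * Complex.exp (-(n * t * Complex.I)) * u (circleMap 0 1 t))
    (f := fun t => (poissonKernel 0 (circleMap 0 r θ) (circleMap 0 1 t) : ℂ) * u (circleMap 0 1 t))
    (bound := fun n _ => r ^ n.natAbs * B) ?_ ?_ ?_ ?_ ?_
  rotate_left
  · intro n
    exact (Continuous.mul (by fun_prop) huc).aestronglyMeasurable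
  · intro n
    refine ae_of_all _ fun t _ => ?_
    rw [norm_mul, norm_mul, norm_mul, norm_exp_coeff, norm_pow, Complex.norm_real,
      Real.norm_eq_abs, abs_of_nonneg h0,
      show (n * θ * Complex.I : ℂ) = ((n * θ : ℝ) : ℂ) * Complex.I by push_cast; ring,
      Complex.norm_exp_ofReal_mul_I, mul_one, mul_one]
    exact mul_le_mul_of_nonneg_left (hB' t) (by positivity)
  · exact ae_of_all _ fun t _ => (summable_pow_natAbs h0 h1).mul_right B
  · exact intervalIntegrable_const
  · exact ae_of_all _ fun t _ => (hasSum_poissonKernel h0 h1 θ t).mul_right _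
  have key2 := key.mul_left (2 * Real.pi : ℂ)⁻¹
  have hval : poissonIntegral u (circleMap 0 r θ) = (2 * Real.pi : ℂ)⁻¹ *
      ∫ t in (0 : ℝ)..2 * Real.pi,
        (poissonKernel 0 (circleMap 0 r θ) (circleMap 0 1 t) : ℂ) * u (circleMap 0 1 t) := by
    rw [poissonIntegral, Real.circleAverage_def]
    simp only [Complex.real_smul]
    push_cast
    rfl
  rw [hval]
  refine hasSum_of_forall_eq key2 fun n => ?_
  unfold circleCoeff
  have : ∀ t : ℝ, (r : ℂ) ^ n.natAbs * Complex.exp (n * θ * Complex.I)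
        * Complex.exp (-(n * t * Complex.I)) * u (circleMap 0 1 t) =
      ((r : ℂ) ^ n.natAbs * Complex.exp (n * θ * Complex.I)) *
        (u (circleMap 0 1 t) * Complex.exp (-(n * t * Complex.I))) := fun t => by ring
  simp_rw [this]
  rw [intervalIntegral.integral_const_mul]
  ring

/-- Fourier inversion on a circle. -/
theorem hasSum_circleCoeff {u : ℂ → ℂ} {r : ℝ} (h0 : 0 ≤ r)
    (hu : ContinuousOn u (sphere 0 r)) (hs : Summable fun n : ℤ => circleCoeff u n r) (θ : ℝ) :
    HasSum (fun n : ℤ => circleCoeff u n r * Complex.exp (n * θ * Complex.I))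
      (u (circleMap 0 r θ)) := by
  have hpi : 0 < 2 * Real.pi := Real.two_pi_pos
  have : Fact (0 < 2 * Real.pi) := ⟨hpi⟩
  have hcoe : ∀ x : ℝ, ((AddCircle.toCircle (x : AddCircle (2 * Real.pi)) : Circle) : ℂ) =
      Complex.exp (x * Complex.I) := by
    intro x
    rw [AddCircle.toCircle_apply_mk, Circle.coe_exp]
    congr 2
    have : (2 * Real.pi) ≠ 0 := hpi.ne'
    field_simp
  set f : C(AddCircle (2 * Real.pi), ℂ) :=
    ⟨fun x => u (r * (AddCircle.toCircle x : ℂ)), hu.comp_continuous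
      (continuous_const.mul (continuous_subtype_val.comp AddCircle.continuous_toCircle))
      (fun x => by
        rw [mem_sphere_zero_iff_norm, norm_mul, Circle.norm_coe, mul_one, Complex.norm_real,
          Real.norm_eq_abs, abs_of_nonneg h0])⟩ with hf
  have hfx : ∀ x : ℝ, f (x : AddCircle (2 * Real.pi)) = u (circleMap 0 r x) := by
    intro x
    simp [hf, hcoe, circleMap]
  have hcoef : ∀ n : ℤ, fourierCoeff f n = circleCoeff u n r := by
    intro n
    rw [fourierCoeff_eq_intervalIntegral f n 0, circleCoeff, zero_add, Complex.real_smul]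
    push_cast
    rw [one_div]
    congr 1
    refine intervalIntegral.integral_congr fun x _ => ?_
    simp only [hfx, fourier_coe_apply, smul_eq_mul]
    rw [mul_comm]
    congr 2
    have : (Real.pi : ℂ) ≠ 0 := by exact_mod_cast Real.pi_ne_zero
    push_cast
    field_simp
  have := has_pointwise_sum_fourier_series_of_summable (f := f)
    (by simpa only [← hcoef] using hs) (θ : AddCircle (2 * Real.pi))
  rw [hfx] at this
  refine hasSum_of_forall_eq this fun n => ?_
  rw [hcoef, smul_eq_mul, fourier_coe_apply]
  congr 2
  have : (Real.pi : ℂ) ≠ 0 := by exact_mod_cast Real.pi_ne_zero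
  push_cast
  field_simp

/-- The Poisson integral is bounded by the supremum of its modulus. -/
lemma norm_poissonIntegral_le_diskSup {u : ℂ → ℂ} (hu : ContinuousOn u (sphere 0 1)) {z : ℂ}
    (hz : z ∈ ball (0 : ℂ) 1) : ‖poissonIntegral u z‖ ≤ diskSup (poissonIntegral u) := by
  -- A real supremum over an unbounded family is 0 by convention, so boundedness has to be proved;
  -- it follows from positivity of the kernel and its mean value 1.
  refine le_ciSup (f := fun z : ball (0 : ℂ) 1 => ‖poissonIntegral u z‖) ?_ ⟨z, hz⟩
  obtain ⟨B, hB⟩ := (isCompact_sphere (0 : ℂ) 1).exists_bound_of_continuousOn hu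
  refine ⟨B, ?_⟩
  rintro _ ⟨⟨w, hw⟩, rfl⟩
  have hw1 : ‖w‖ < 1 := by simpa using hw
  have hB0 : 0 ≤ B := (norm_nonneg _).trans (hB 1 (by simp))
  have hker : ∀ ζ ∈ sphere (0 : ℂ) 1, 0 ≤ poissonKernel 0 w ζ := by
    intro ζ hζ
    have hζ1 : ‖ζ‖ = 1 := by simpa using hζ
    rw [poissonKernel_def, sub_zero, sub_zero, hζ1]
    have : ‖w‖ ^ 2 ≤ 1 := pow_le_one₀ (norm_nonneg _) hw1.le
    exact div_nonneg (by linarith) (by positivity)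
  have hkc : ContinuousOn (poissonKernel 0 w) (sphere 0 1) := by
    have h : ∀ ζ ∈ sphere (0 : ℂ) 1, ‖ζ - 0 - (w - 0)‖ ^ 2 ≠ 0 := by
      intro ζ hζ h
      have : ζ = w := by simpa [sub_eq_zero] using h
      rw [this] at hζ
      simp at hζ; linarith
    exact ContinuousOn.div (by fun_prop) (by fun_prop) h
  have hone : Real.circleAverage (fun ζ => poissonKernel 0 w ζ) 0 1 = 1 := by
    have := (diffContOnCl_const (𝕜 := ℂ) (c := (1 : ℂ)) (s := ball (0 : ℂ) 1)).circleAverage_poissonKernel_smul hw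
    have h2 := congrArg Complex.re this
    rw [← Complex.reCLM_apply, ← ContinuousLinearMap.circleAverage_comp_comm] at h2
    · simpa [Function.comp_def] using h2
    · refine ContinuousOn.circleIntegrable zero_le_one ?_
      exact hkc.smul continuousOn_const
  have hint : ∀ f : ℂ → ℝ, ContinuousOn f (sphere 0 1) →
      IntervalIntegrable (fun t => f (circleMap 0 1 t)) volume 0 (2 * Real.pi) := fun f hf =>
    (hf.comp_continuous (continuous_circleMap 0 1) (fun t => by simp)).intervalIntegrable _ _
  show ‖poissonIntegral u w‖ ≤ B
  rw [poissonIntegral, Real.circleAverage_def, norm_smul]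
  calc _ ≤ ‖(2 * Real.pi)⁻¹‖ * ∫ t in (0 : ℝ)..2 * Real.pi,
        poissonKernel 0 w (circleMap 0 1 t) * B := by
        refine mul_le_mul_of_nonneg_left ?_ (norm_nonneg _)
        refine intervalIntegral.norm_integral_le_of_norm_le Real.two_pi_pos.le
          (ae_of_all _ fun t _ => ?_) ((hint _ hkc).mul_const B)
        have hm : circleMap 0 1 t ∈ sphere (0 : ℂ) 1 := by simp
        rw [norm_smul, Real.norm_eq_abs, abs_of_nonneg (hker _ hm)]
        exact mul_le_mul_of_nonneg_left (hB _ hm) (hker _ hm)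
    _ = B := by
        rw [intervalIntegral.integral_mul_const, ← mul_assoc, Real.norm_eq_abs,
          abs_of_pos (by positivity [Real.pi_pos])]
        rw [Real.circleAverage_def, smul_eq_mul] at hone
        rw [hone, one_mul]

/-! ### Fourier modes of biharmonic functions -/

lemma contDiffOn_dirD {v : ℂ → ℂ} {k : ℕ} (hv : ContDiffOn ℝ (k + 1) v (ball 0 1)) (s : ℤ) :
    ContDiffOn ℝ k (dirD s v) (ball 0 1) := by
  have h := hv.fderiv_of_isOpen isOpen_ball le_rfl
  exact (h.clm_apply contDiffOn_const).add
    (contDiffOn_const.mul (h.clm_apply contDiffOn_const))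

lemma laplacian_eq_fderiv_fderiv (v : ℂ → ℂ) (z : ℂ) :
    Δ v z = fderiv ℝ (fderiv ℝ v) z 1 1 + fderiv ℝ (fderiv ℝ v) z Complex.I Complex.I := by
  rw [InnerProductSpace.laplacian_eq_iteratedFDeriv_complexPlane]
  simp [iteratedFDeriv_two_apply]

lemma contDiffOn_laplacian {v : ℂ → ℂ} {k : ℕ} (hv : ContDiffOn ℝ (k + 2) v (ball 0 1)) :
    ContDiffOn ℝ k (Δ v) (ball 0 1) := by
  have h1 : ContDiffOn ℝ (k + 1) (fderiv ℝ v) (ball 0 1) :=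
    hv.fderiv_of_isOpen isOpen_ball (by rw [add_assoc, one_add_one_eq_two])
  have h := h1.fderiv_of_isOpen isOpen_ball le_rfl
  refine ContDiffOn.congr ?_ (fun z _ => laplacian_eq_fderiv_fderiv v z)
  exact ((h.clm_apply contDiffOn_const).clm_apply contDiffOn_const).add
    ((h.clm_apply contDiffOn_const).clm_apply contDiffOn_const)

lemma dirD_neg_dirD {v : ℂ → ℂ} (hv : ContDiffOn ℝ 2 v (ball 0 1)) {s : ℤ} (hs : s = 1 ∨ s = -1)
    {z : ℂ} (hz : z ∈ ball (0 : ℂ) 1) : dirD (-s) (dirD s v) z = Δ v z := by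
  have hz' := isOpen_ball.mem_nhds hz
  have h1 : DifferentiableAt ℝ (fderiv ℝ v) z :=
    ((hv.fderiv_of_isOpen (m := 1) isOpen_ball (by norm_num)).differentiableOn
      one_ne_zero).differentiableAt hz'
  have hsymm : fderiv ℝ (fderiv ℝ v) z Complex.I 1 = fderiv ℝ (fderiv ℝ v) z 1 Complex.I :=
    ((hv.contDiffAt hz').isSymmSndFDerivAt (by simp)) _ _
  have hap : ∀ e : ℂ, HasFDerivAt (fun z => fderiv ℝ v z e)
      ((fderiv ℝ (fderiv ℝ v) z).flip e) z := by
    intro e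
    simpa using h1.hasFDerivAt.clm_apply (hasFDerivAt_const e z)
  have hD : HasFDerivAt (dirD s v) ((fderiv ℝ (fderiv ℝ v) z).flip 1
      + (s * Complex.I) • (fderiv ℝ (fderiv ℝ v) z).flip Complex.I) z :=
    (hap 1).add ((hap Complex.I).const_mul _)
  have hs2 : (s : ℂ) * s = 1 := by rcases hs with rfl | rfl <;> simp
  rw [laplacian_eq_fderiv_fderiv, dirD, hD.fderiv]
  simp only [add_apply, smul_apply, smul_eq_mul,
    ContinuousLinearMap.flip_apply]
  rw [hsymm]
  push_cast
  linear_combination (-(fderiv ℝ (fderiv ℝ v) z Complex.I Complex.I) * s ^ 2) * Complex.I_sq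
    + fderiv ℝ (fderiv ℝ v) z Complex.I Complex.I * hs2

lemma dirD_one (v : ℂ → ℂ) (z : ℂ) : dirD 1 v z = 2 * dbar v z := by
  simp only [dirD, dbar]; push_cast; ring

/-- This shift matches mode n + 1 of ∂̄h, which enters the equation for mode n of h, with mode n of
φ₁. -/
lemma circleCoeff_twist (φ : ℂ → ℂ) (n : ℤ) :
    circleCoeff (twist φ) n 1 = circleCoeff φ (n + 1) 1 := by
  unfold circleCoeff
  congr 1
  refine intervalIntegral.integral_congr fun θ _ => ?_
  have : conj (circleMap 0 1 θ) = Complex.exp (-(θ * Complex.I)) := by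
    simp [circleMap, ← Complex.exp_conj]
  simp only [twist, this]
  rw [mul_assoc, ← Complex.exp_add]
  congr 2; push_cast; ring

lemma continuousOn_twist {φ : ℂ → ℂ} (hφ : ContinuousOn φ (sphere 0 1)) :
    ContinuousOn (twist φ) (sphere 0 1) :=
  hφ.mul Complex.continuous_conj.continuousOn

/-- Modes n of h and Δh, and modes n + s of their images under ∂_x + si∂_y, satisfy the radial
system, because ∂_x - si∂_y completes that operator to Δ. -/
theorem circleCoeff_biharmonic_estimate {h φ : ℂ → ℂ} {M : ℝ}
    (hh : ContDiffOn ℝ 4 h (ball 0 1)) (hg : ∀ z ∈ ball (0 : ℂ) 1, ‖Δ (Δ h) z‖ ≤ M)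
    (hdbar : ∀ ζ ∈ sphere (0 : ℂ) 1, Tendsto (dbar h) (𝓝[ball 0 1] ζ) (𝓝 (φ ζ)))
    (h0 : ∀ ζ ∈ sphere (0 : ℂ) 1, Tendsto h (𝓝[ball 0 1] ζ) (𝓝 0)) (n : ℤ) :
    (∀ r ∈ Ioo (0 : ℝ) 1, ‖circleCoeff h n r + circleCoeff (twist φ) n 1 * (1 - (r : ℂ) ^ 2)
        * (r : ℂ) ^ n.natAbs‖ ≤ 2 * (M / (n.natAbs + 2) ^ 2) * (1 - r)) ∧
    Tendsto (fun r : ℝ => (circleCoeff h n r + circleCoeff (twist φ) n 1 * (1 - (r : ℂ) ^ 2)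
        * (r : ℂ) ^ n.natAbs) / (1 - r : ℝ)) (𝓝[<] 1) (𝓝 0) := by
  have hM : 0 ≤ M := (norm_nonneg _).trans (hg 0 (by simp))
  generalize hm : n.natAbs = m
  -- Taking s to be the sign of n makes the singular coefficients m/r and -(m + 1)/r with m = |n|.
  obtain ⟨s, hs, hsn⟩ : ∃ s : ℤ, (s = 1 ∨ s = -1) ∧ s * n = m := by
    rcases le_total 0 n with hn | hn
    · exact ⟨1, Or.inl rfl, by omega⟩
    · exact ⟨-1, Or.inr rfl, by omega⟩
  have hs' : -s = 1 ∨ -s = -1 := by omega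
  have hs2 : s * s = 1 := by rcases hs with rfl | rfl <;> rfl
  have hΔ : ContDiffOn ℝ 2 (Δ h) (ball 0 1) := contDiffOn_laplacian (k := 2) (by norm_num; exact hh)
  have hh2 : ContDiffOn ℝ 2 h (ball 0 1) := hh.of_le (by norm_num)
  have hsys : ∀ v : ℂ → ℂ, ContDiffOn ℝ 2 v (ball 0 1) → ∀ r ∈ Ioo (0 : ℝ) 1,
      HasDerivAt (circleCoeff v n)
        (circleCoeff (dirD s v) (n + s) r + (m : ℂ) / r * circleCoeff v n r) r ∧
      HasDerivAt (circleCoeff (dirD s v) (n + s))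
        (circleCoeff (Δ v) n r - ((m : ℂ) + 1) / r * circleCoeff (dirD s v) (n + s) r) r := by
    intro v hv r hr
    constructor
    · have := hasDerivAt_circleCoeff (hv.of_le (by norm_num)) hs n hr.1 hr.2
      rw [hsn] at this
      exact_mod_cast this
    · have := hasDerivAt_circleCoeff (contDiffOn_dirD (k := 1) (by norm_num; exact hv) s) hs' (n + s)
        hr.1 hr.2
      refine this.congr_deriv ?_
      rw [add_neg_cancel_right, circleCoeff_congr (fun θ => dirD_neg_dirD hv hs
        (circleMap_mem_unit_ball hr.1.le hr.2 θ))]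
      have : -s * (n + s) = -(m + 1 : ℤ) := by rw [← hsn, ← hs2]; ring
      rw [this]
      push_cast
      ring
  have hcont0 : ∀ v : ℂ → ℂ, ContDiffOn ℝ 2 v (ball 0 1) →
      ContinuousWithinAt (circleCoeff (dirD s v) (n + s)) (Ioi 0) 0 := by
    intro v hv
    have hc : ContinuousOn (circleCoeff (dirD s v) (n + s)) (Ico 0 1) :=
      continuousOn_circleCoeff (contDiffOn_dirD (k := 1) (by norm_num; exact hv) s).continuousOn
        (fun r hr θ => circleMap_mem_unit_ball hr.1 hr.2 θ) _
    have h2 := (hc 0 (by simp)).mono (Ioo_subset_Ico_self)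
    rw [ContinuousWithinAt, nhdsWithin_Ioo_eq_nhdsGT zero_lt_one] at h2
    exact h2
  have ha1 : Tendsto (circleCoeff h n) (𝓝[<] 1) (𝓝 0) := by
    have := tendsto_circleCoeff_one (ψ := fun _ => 0) hh.continuousOn h0 n
    simpa [circleCoeff] using this
  have hdc : ContinuousOn (dbar h) (ball 0 1) := by
    have := (contDiffOn_dirD (k := 1) (by norm_num; exact hh2) 1).continuousOn
    refine (this.const_mul (1 / 2)).congr fun z _ => ?_
    simp only [dirD_one]; ring
  have hone : Tendsto (circleCoeff (dirD 1 h) (n + 1)) (𝓝[<] 1)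
      (𝓝 (2 * circleCoeff (twist φ) n 1)) := by
    rw [circleCoeff_twist]
    refine ((tendsto_circleCoeff_one hdc hdbar (n + 1)).const_mul 2).congr fun r => ?_
    rw [← circleCoeff_const_mul]
    exact circleCoeff_congr (fun θ => (dirD_one h _).symm) _
  have hb1 : Tendsto (circleCoeff (dirD s h) (n + s)) (𝓝[<] 1)
      (𝓝 (2 * circleCoeff (twist φ) n 1)) := by
    rcases hs with rfl | rfl
    · exact hone
    -- The boundary condition concerns s = 1 only. Equating the two formulas for the radial
    -- derivative of mode n of h shows that passing to s = -1 adds 2n/r times that mode, which tends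
    -- to 0.
    · have hinv : Tendsto (fun r : ℝ => (n : ℂ) / r) (𝓝[<] 1) (𝓝 n) := by
        have : ContinuousAt (fun r : ℝ => (n : ℂ) / r) 1 :=
          continuousAt_const.div Complex.continuous_ofReal.continuousAt (by simp)
        simpa [ContinuousAt] using this.tendsto.mono_left (nhdsWithin_le_nhds (s := Iio 1))
      have h3 := hone.add ((hinv.mul ha1).const_mul 2)
      rw [mul_zero, mul_zero, add_zero] at h3
      refine h3.congr' ?_
      filter_upwards [Ioo_mem_nhdsLT (zero_lt_one : (0 : ℝ) < 1)] with r hr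
      have e1 := hasDerivAt_circleCoeff (hh.of_le (by norm_num)) (Or.inl rfl : (1 : ℤ) = 1 ∨ _) n hr.1 hr.2
      have e2 := hasDerivAt_circleCoeff (hh.of_le (by norm_num)) (Or.inr rfl : (-1 : ℤ) = 1 ∨ _) n hr.1 hr.2
      have := e1.unique e2
      push_cast at this ⊢
      linear_combination this
  exact radial_biharmonic_estimate hM (fun r hr => (hsys h hh2 r hr).1)
    (fun r hr => (hsys h hh2 r hr).2) (fun r hr => (hsys _ hΔ r hr).1)
    (fun r hr => (hsys _ hΔ r hr).2)
    (fun r hr => norm_circleCoeff_le fun θ => hg _ (circleMap_mem_unit_ball hr.1.le hr.2 θ))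
    (hcont0 h hh2) (hcont0 _ hΔ) ha1 hb1

/-! ### Summation over the modes -/

lemma summable_inv_natAbs_add_two_sq : Summable fun n : ℤ => 1 / ((n.natAbs : ℝ) + 2) ^ 2 := by
  have h : Summable fun n : ℕ => 1 / ((n : ℝ) + 2) ^ 2 := by
    have := (summable_nat_add_iff 2).2 (Real.summable_one_div_nat_pow.2 one_lt_two)
    exact_mod_cast this
  refine Summable.of_nat_of_neg_add_one (by simpa using h) ?_
  have h2 := (summable_nat_add_iff 1).2 h
  refine h2.congr fun n => ?_
  have : (-((n : ℤ) + 1)).natAbs = n + 1 := by omega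
  rw [this]

/-- Boundary expansion of a solution of the inhomogeneous biharmonic equation with zero boundary
values. -/
theorem tendsto_biharmonic_radial {h φ : ℂ → ℂ} {M : ℝ}
    (hh : ContDiffOn ℝ 4 h (ball 0 1)) (hg : ∀ z ∈ ball (0 : ℂ) 1, ‖Δ (Δ h) z‖ ≤ M)
    (hφ : ContinuousOn φ (sphere 0 1))
    (hdbar : ∀ ζ ∈ sphere (0 : ℂ) 1, Tendsto (dbar h) (𝓝[ball 0 1] ζ) (𝓝 (φ ζ)))
    (h0 : ∀ ζ ∈ sphere (0 : ℂ) 1, Tendsto h (𝓝[ball 0 1] ζ) (𝓝 0)) (θ : ℝ) :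
    Tendsto (fun r : ℝ => (h (circleMap 0 r θ)
      + (1 - (r : ℂ) ^ 2) * poissonIntegral (twist φ) (circleMap 0 r θ)) / (1 - r : ℝ))
      (𝓝[<] 1) (𝓝 0) := by
  have hest := circleCoeff_biharmonic_estimate hh hg hdbar h0
  have hexp : ∀ n : ℤ, ‖Complex.exp (n * θ * Complex.I)‖ = 1 := fun n => by
    rw [show (n * θ * Complex.I : ℂ) = ((n * θ : ℝ) : ℂ) * Complex.I by push_cast; ring,
      Complex.norm_exp_ofReal_mul_I]
  set E : ℝ → ℤ → ℂ := fun r n => (circleCoeff h n r + circleCoeff (twist φ) n 1 *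
    (1 - (r : ℂ) ^ 2) * (r : ℂ) ^ n.natAbs) / (1 - r : ℝ) * Complex.exp (n * θ * Complex.I) with hE
  have hbs : Summable fun n : ℤ => 2 * M * (1 / ((n.natAbs : ℝ) + 2) ^ 2) :=
    summable_inv_natAbs_add_two_sq.mul_left _
  have hlim : Tendsto (fun r => ∑' n, E r n) (𝓝[<] 1) (𝓝 (∑' _ : ℤ, (0 : ℂ))) := by
    refine tendsto_tsum_of_dominated_convergence hbs (fun n => ?_) ?_
    · simpa only [hE, zero_mul] using (hest n).2.mul_const (Complex.exp (n * θ * Complex.I))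
    · filter_upwards [Ioo_mem_nhdsLT (zero_lt_one : (0 : ℝ) < 1)] with r hr n
      have hpos : 0 < 1 - r := sub_pos.2 hr.2
      rw [hE, norm_mul, hexp, mul_one, norm_div, Complex.norm_real, Real.norm_eq_abs,
        abs_of_pos hpos, div_le_iff₀ hpos]
      refine ((hest n).1 r hr).trans_eq ?_
      ring
  rw [tsum_zero] at hlim
  refine hlim.congr' ?_
  filter_upwards [Ioo_mem_nhdsLT (zero_lt_one : (0 : ℝ) < 1)] with r hr
  have htw := continuousOn_twist hφ
  have hP := hasSum_poissonIntegral htw hr.1.le hr.2 θ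
  have hsub : sphere (0 : ℂ) r ⊆ ball 0 1 := fun z hz => by
    rw [mem_sphere_zero_iff_norm] at hz; rw [mem_ball_zero_iff, hz]; exact hr.2
  have hPs : Summable fun n : ℤ => circleCoeff (twist φ) n 1 * (1 - (r : ℂ) ^ 2) *
      (r : ℂ) ^ n.natAbs := by
    refine Summable.of_norm ?_
    refine (hP.summable.norm.mul_left ‖(1 - (r : ℂ) ^ 2)‖).congr fun n => ?_
    simp only [norm_mul, hexp]; ring
  have hEs : Summable fun n : ℤ => circleCoeff h n r + circleCoeff (twist φ) n 1 *
      (1 - (r : ℂ) ^ 2) * (r : ℂ) ^ n.natAbs := by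
    refine Summable.of_norm_bounded (hbs.mul_right (1 - r)) fun n => ?_
    refine ((hest n).1 r hr).trans_eq ?_
    ring
  -- Coefficients of h are summable at radius r as the difference of the error terms and the Poisson
  -- terms.
  have hF := hasSum_circleCoeff hr.1.le (hh.continuousOn.mono hsub)
    ((hEs.sub hPs).congr fun n => by ring) θ
  have htot := ((hF.add (hP.mul_left (1 - (r : ℂ) ^ 2))).div_const ((1 - r : ℝ) : ℂ))
  rw [← htot.tsum_eq]
  refine tsum_congr fun n => ?_
  simp only [hE]
  ring

/-! ### The analytic part and the Schwarz–Pick estimate -/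

lemma laplacian_eq_zero_of_differentiableOn {Φ : ℂ → ℂ} (hΦ : DifferentiableOn ℂ Φ (ball 0 1))
    {z : ℂ} (hz : z ∈ ball (0 : ℂ) 1) : Δ Φ z = 0 :=
  (hΦ.analyticAt (isOpen_ball.mem_nhds hz)).harmonicAt.2.eq_of_nhds

lemma contDiffOn_real_of_differentiableOn {Φ : ℂ → ℂ} (hΦ : DifferentiableOn ℂ Φ (ball 0 1)) :
    ContDiffOn ℝ 4 Φ (ball 0 1) :=
  (hΦ.contDiffOn isOpen_ball).restrict_scalars ℝ

lemma dbar_eq_zero_of_differentiableOn {Φ : ℂ → ℂ} (hΦ : DifferentiableOn ℂ Φ (ball 0 1))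
    {z : ℂ} (hz : z ∈ ball (0 : ℂ) 1) : dbar Φ z = 0 := by
  have hd := hΦ.differentiableAt (isOpen_ball.mem_nhds hz)
  have h1 : fderiv ℂ Φ z Complex.I = Complex.I * fderiv ℂ Φ z 1 := by
    rw [← smul_eq_mul, ← map_smul, smul_eq_mul, mul_one]
  rw [dbar, hd.fderiv_restrictScalars ℝ, ContinuousLinearMap.coe_restrictScalars', h1]
  linear_combination (1 / 2 : ℂ) * fderiv ℂ Φ z 1 * Complex.I_sq

lemma laplacian_laplacian_sub {f Φ : ℂ → ℂ} (hf : ContDiffOn ℝ 4 f (ball 0 1))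
    (hΦ : DifferentiableOn ℂ Φ (ball 0 1)) {z : ℂ} (hz : z ∈ ball (0 : ℂ) 1) :
    Δ (Δ (f - Φ)) z = Δ (Δ f) z := by
  have hz' := isOpen_ball.mem_nhds hz
  refine (InnerProductSpace.laplacian_congr_nhds ?_).eq_of_nhds
  filter_upwards [hz'] with y hy
  have hy' := isOpen_ball.mem_nhds hy
  rw [((hf.contDiffAt hy').of_le (by norm_num)).laplacian_sub
    (((contDiffOn_real_of_differentiableOn hΦ).contDiffAt hy').of_le (by norm_num)),
    laplacian_eq_zero_of_differentiableOn hΦ hy, sub_zero]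

lemma dbar_sub {f Φ : ℂ → ℂ} (hf : ContDiffOn ℝ 4 f (ball 0 1))
    (hΦ : DifferentiableOn ℂ Φ (ball 0 1)) {z : ℂ} (hz : z ∈ ball (0 : ℂ) 1) :
    dbar (f - Φ) z = dbar f z := by
  have hz' := isOpen_ball.mem_nhds hz
  have hd : DifferentiableAt ℝ f z := (hf.differentiableOn (by norm_num)).differentiableAt hz'
  have hd' : DifferentiableAt ℝ Φ z := (hΦ.differentiableAt hz').restrictScalars ℝ
  have h0 := dbar_eq_zero_of_differentiableOn hΦ hz
  simp only [dbar] at h0 ⊢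
  rw [fderiv_sub hd hd']
  simp only [sub_apply]
  linear_combination -h0

lemma poissonIntegral_zero_of_differentiableOn {Φ : ℂ → ℂ} (hc : ContinuousOn Φ (closedBall 0 1))
    (hΦ : DifferentiableOn ℂ Φ (ball 0 1)) : poissonIntegral Φ 0 = Φ 0 :=
  (DiffContOnCl.mk_ball hΦ hc).circleAverage_poissonKernel_smul (by simp)

lemma norm_one_sub_conj_mul_sq (c w : ℂ) :
    ‖1 - conj c * w‖ ^ 2 = ‖w - c‖ ^ 2 + (1 - ‖c‖ ^ 2) * (1 - ‖w‖ ^ 2) := by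
  simp only [Complex.sq_norm, Complex.normSq_apply]
  simp
  ring

/-- The Schwarz–Pick estimate at the origin. -/
theorem norm_le_of_mapsTo_closedBall {Φ : ℂ → ℂ} (hΦ : DifferentiableOn ℂ Φ (ball 0 1))
    (hb : ∀ z ∈ ball (0 : ℂ) 1, ‖Φ z‖ ≤ 1) (h0 : ‖Φ 0‖ < 1) {z : ℂ} (hz : z ∈ ball (0 : ℂ) 1) :
    ‖Φ z‖ ≤ (‖Φ 0‖ + ‖z‖) / (1 + ‖Φ 0‖ * ‖z‖) := by
  set c := Φ 0 with hc
  have hlt : ∀ y ∈ ball (0 : ℂ) 1, ‖conj c * Φ y‖ < 1 := by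
    intro y hy
    rw [norm_mul, Complex.norm_conj]
    nlinarith [hb y hy, norm_nonneg c, norm_nonneg (Φ y)]
  have hne : ∀ y ∈ ball (0 : ℂ) 1, 1 - conj c * Φ y ≠ 0 := by
    intro y hy h
    have := hlt y hy
    rw [← sub_eq_zero.1 h, norm_one] at this
    exact lt_irrefl _ this
  have hΨ : DifferentiableOn ℂ (fun y => (Φ y - c) / (1 - conj c * Φ y)) (ball 0 1) :=
    (hΦ.sub_const c).div ((differentiableOn_const 1).sub (hΦ.const_mul (conj c))) hne
  have hmaps : MapsTo (fun y => (Φ y - c) / (1 - conj c * Φ y)) (ball 0 1) (closedBall 0 1) := by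
    intro y hy
    rw [mem_closedBall_zero_iff, norm_div]
    refine div_le_one_of_le₀ ?_ (norm_nonneg _)
    refine le_of_sq_le_sq ?_ (norm_nonneg _)
    rw [norm_one_sub_conj_mul_sq]
    have h1 : ‖c‖ ^ 2 ≤ 1 := pow_le_one₀ (norm_nonneg _) h0.le
    have h2 : ‖Φ y‖ ^ 2 ≤ 1 := pow_le_one₀ (norm_nonneg _) (hb y hy)
    nlinarith
  have hz1 : ‖z‖ < 1 := by simpa using hz
  have hS := Complex.norm_le_norm_of_mapsTo_ball hΨ hmaps (by simp [hc]) hz1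
  rw [norm_div, div_le_iff₀ (norm_pos_iff.2 (hne z hz))] at hS
  have hsq : ‖Φ z - c‖ ^ 2 ≤ ‖z‖ ^ 2 * ‖1 - conj c * Φ z‖ ^ 2 := by
    rw [← mul_pow]; exact pow_le_pow_left₀ (norm_nonneg _) hS 2
  have hid := norm_one_sub_conj_mul_sq c (Φ z)
  have hlow : 1 - ‖c‖ * ‖Φ z‖ ≤ ‖1 - conj c * Φ z‖ := by
    have := norm_sub_norm_le (1 : ℂ) (conj c * Φ z)
    rwa [norm_one, norm_mul, Complex.norm_conj] at this
  have hpos : 0 ≤ 1 - ‖c‖ * ‖Φ z‖ := by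
    have := hlt z hz
    rw [norm_mul, Complex.norm_conj] at this
    linarith
  have hr2 : 0 ≤ 1 - ‖z‖ ^ 2 := by
    have : ‖z‖ ^ 2 ≤ 1 := pow_le_one₀ (norm_nonneg _) hz1.le
    linarith
  have hlow2 := pow_le_pow_left₀ hpos hlow 2
  -- With w = Φ(z), the identity and the disk bound give (1 - |z|²)|1 - c̄w|² ≤ (1 - |c|²)(1 - |w|²)
  -- = (1 - |c||w|)² - (|w| - |c|)². The lower bound |1 - c̄w| ≥ 1 - |c||w| finishes.
  have hkey : (‖Φ z‖ - ‖c‖) ^ 2 ≤ (‖z‖ * (1 - ‖c‖ * ‖Φ z‖)) ^ 2 := by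
    nlinarith [mul_le_mul_of_nonneg_left hlow2 hr2]
  have h3 := le_of_sq_le_sq hkey (mul_nonneg (norm_nonneg _) hpos)
  rw [le_div_iff₀ (by positivity)]
  linarith

/-! ### The boundary inequality -/

lemma tendsto_radial_nhdsWithin {η : ℂ} (hη : η ∈ sphere (0 : ℂ) 1) :
    Tendsto (fun r : ℝ => (r : ℂ) * η) (𝓝[<] 1) (𝓝[ball 0 1] η) := by
  have hη1 : ‖η‖ = 1 := by simpa using hη
  refine tendsto_nhdsWithin_iff.2 ⟨?_, ?_⟩
  · have : Continuous fun r : ℝ => (r : ℂ) * η := by fun_prop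
    simpa using (this.tendsto 1).mono_left (nhdsWithin_le_nhds (s := Iio 1))
  · filter_upwards [Ioo_mem_nhdsLT (zero_lt_one : (0 : ℝ) < 1)] with r hr
    rw [mem_ball_zero_iff, norm_mul, hη1, mul_one, Complex.norm_real, Real.norm_eq_abs,
      abs_of_pos hr.1]
    exact hr.2

theorem schwarzBound_le_radialLiminf {g φ Φ f : ℂ → ℂ} (H : IsAdmissible g φ Φ f) {η : ℂ}
    (hη : η ∈ sphere (0 : ℂ) 1)
    (hlim : Tendsto (fun r : ℝ => ‖f (r * η)‖) (𝓝[<] (1 : ℝ)) (𝓝 1)) :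
    ((schwarzBound φ Φ : ℝ) : EReal) ≤ radialLiminf f η := by
  have hη1 : ‖η‖ = 1 := by simpa using hη
  obtain ⟨M, hM⟩ := (isCompact_closedBall (0 : ℂ) 1).exists_bound_of_continuousOn H.continuousOn_g
  have hfη : ‖f η‖ = 1 := by
    have h1 := ((H.tendsto η hη).comp (tendsto_radial_nhdsWithin hη)).norm
    rw [H.eq_on_circle η hη]
    exact tendsto_nhds_unique h1 hlim
  have hh : ContDiffOn ℝ 4 (f - Φ) (ball 0 1) :=
    H.contDiffOn.sub (contDiffOn_real_of_differentiableOn H.analytic_Φ)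
  have hcirc : ∀ r : ℝ, circleMap 0 r (Complex.arg η) = r * η := by
    intro r
    have := Complex.norm_mul_exp_arg_mul_I η
    rw [hη1, Complex.ofReal_one, one_mul] at this
    rw [circleMap, zero_add, this]
  have hexp := tendsto_biharmonic_radial (h := f - Φ) (φ := φ) (M := M) hh
    (fun z hz => by
      rw [laplacian_laplacian_sub H.contDiffOn H.analytic_Φ hz, H.biharmonic z hz]
      exact hM z (ball_subset_closedBall hz))
    H.continuousOn_φ
    (fun ζ hζ => (H.tendsto_dbar ζ hζ).congr' (by
      filter_upwards [self_mem_nhdsWithin] with z hz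
      exact (dbar_sub H.contDiffOn H.analytic_Φ hz).symm))
    (fun ζ hζ => by
      have h1 := (H.continuousOn_Φ ζ (sphere_subset_closedBall hζ)).mono_left
        (nhdsWithin_mono _ ball_subset_closedBall)
      have h2 := (H.tendsto ζ hζ).sub h1
      rwa [sub_self] at h2)
    (Complex.arg η)
  simp only [hcirc] at hexp
  set S := diskSup (poissonIntegral (twist φ)) with hS
  have htw := continuousOn_twist H.continuousOn_φ
  have hS0 : 0 ≤ S := (norm_nonneg _).trans
    (norm_poissonIntegral_le_diskSup htw (mem_ball_self one_pos))
  have hcenter := poissonIntegral_zero_of_differentiableOn H.continuousOn_Φ H.analytic_Φ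
  have ha1 : ‖Φ 0‖ < 1 := by
    have := H.center_lt
    rw [hcenter] at this
    refine this.trans_le (div_le_one_of_le₀ ?_ ?_) <;> linarith
  rw [schwarzBound, hcenter, ← hS]
  set a := ‖Φ 0‖ with ha
  have ha0 : 0 ≤ a := norm_nonneg _
  set A : ℝ → ℂ := fun r => ((f - Φ) (r * η) + (1 - (r : ℂ) ^ 2) *
    poissonIntegral (twist φ) (r * η)) / (1 - r : ℝ) with hA
  -- The error A tends to 0, so it suffices to bound the quotient below pointwise by the claimed
  -- constant minus |A(r)|.
  have hAlim : Tendsto (fun r => ((((1 - a) / (1 + a) - 2 * S) - ‖A r‖ : ℝ) : EReal)) (𝓝[<] 1)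
      (𝓝 (((1 - a) / (1 + a) - 2 * S : ℝ) : EReal)) := by
    refine (continuous_coe_real_ereal.tendsto _).comp ?_
    simpa using hexp.norm.const_sub ((1 - a) / (1 + a) - 2 * S)
  rw [← hAlim.liminf_eq, radialLiminf]
  refine liminf_le_liminf ?_
  filter_upwards [Ioo_mem_nhdsLT (zero_lt_one : (0 : ℝ) < 1)] with r hr
  rw [EReal.coe_le_coe_iff]
  have hr1 : 0 < 1 - r := sub_pos.2 hr.2
  have hr0 := hr.1
  have hnorm : ‖(r : ℂ) * η‖ = r := by
    rw [norm_mul, hη1, mul_one, Complex.norm_real, Real.norm_eq_abs, abs_of_pos hr0]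
  have hmem : (r : ℂ) * η ∈ ball (0 : ℂ) 1 := by
    rw [mem_ball_zero_iff, hnorm]; exact hr.2
  have hrne : ((1 - r : ℝ) : ℂ) ≠ 0 := by exact_mod_cast hr1.ne'
  have hdecomp : f (r * η) = Φ (r * η) + (((1 - r : ℝ) : ℂ) * A r
      - ((1 - r ^ 2 : ℝ) : ℂ) * poissonIntegral (twist φ) (r * η)) := by
    simp only [hA, Pi.sub_apply]
    rw [mul_div_cancel₀ _ hrne]
    push_cast
    ring
  have hPle := norm_poissonIntegral_le_diskSup htw hmem
  have hr2 : 0 ≤ 1 - r ^ 2 := by nlinarith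
  have hfr : ‖f (r * η)‖ ≤ (a + r) / (1 + a * r) + ((1 - r) * ‖A r‖ + (1 - r ^ 2) * S) := by
    rw [hdecomp]
    refine (norm_add_le _ _).trans (add_le_add ?_ ((norm_sub_le _ _).trans ?_))
    · have := norm_le_of_mapsTo_closedBall H.analytic_Φ
        (fun z hz => H.norm_Φ_le z (ball_subset_closedBall hz)) ha1 hmem
      rwa [hnorm] at this
    · rw [norm_mul, norm_mul, Complex.norm_real, Complex.norm_real, Real.norm_eq_abs,
        Real.norm_eq_abs, abs_of_pos hr1, abs_of_nonneg hr2]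
      gcongr
  have hdiff := norm_sub_norm_le (f η) (f (r * η))
  rw [hfη] at hdiff
  rw [le_div_iff₀ hr1]
  have hpick : (1 - a) / (1 + a) * (1 - r) ≤ 1 - (a + r) / (1 + a * r) := by
    have : 1 - (a + r) / (1 + a * r) = (1 - a) / (1 + a * r) * (1 - r) := by
      have : 1 + a * r ≠ 0 := by positivity
      field_simp; ring
    rw [this]
    have h1 : 1 + a * r ≤ 1 + a := by nlinarith
    have h2 : 0 ≤ 1 - a := by linarith
    gcongr
  -- As 1 - r² = 2(1 - r) - (1 - r)², the Poisson term costs at most 2S(1 - r); this is the factor 2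
  -- in the bound.
  nlinarith [mul_nonneg hS0 (sq_nonneg (1 - r))]

/-! ### Extremal functions -/

lemma poissonIntegral_twist_zero : poissonIntegral (twist 0) = 0 := by
  ext z
  simp [poissonIntegral, twist, Real.circleAverage_def]

lemma diskSup_zero : diskSup (0 : ℂ → ℂ) = 0 := by
  simp [diskSup]

lemma isAdmissible_of_analytic {Φ : ℂ → ℂ} (hc : ContinuousOn Φ (closedBall 0 1))
    (hd : DifferentiableOn ℂ Φ (ball 0 1)) (hb : ∀ z ∈ closedBall (0 : ℂ) 1, ‖Φ z‖ ≤ 1)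
    (h0 : ‖Φ 0‖ < 1) : IsAdmissible 0 0 Φ Φ where
  continuousOn_g := continuousOn_const
  continuousOn_φ := continuousOn_const
  contDiffOn := contDiffOn_real_of_differentiableOn hd
  biharmonic z hz := by
    have : Δ Φ =ᶠ[𝓝 z] fun _ => 0 := by
      filter_upwards [isOpen_ball.mem_nhds hz] with y hy
      exact laplacian_eq_zero_of_differentiableOn hd hy
    rw [(InnerProductSpace.laplacian_congr_nhds this).eq_of_nhds]
    simp
  tendsto_dbar ζ _ := by
    refine tendsto_const_nhds.congr' ?_
    filter_upwards [self_mem_nhdsWithin] with z hz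
    exact (dbar_eq_zero_of_differentiableOn hd hz).symm
  tendsto ζ hζ := (hc ζ (sphere_subset_closedBall hζ)).mono_left
    (nhdsWithin_mono _ ball_subset_closedBall)
  eq_on_circle _ _ := rfl
  continuousOn_Φ := hc
  analytic_Φ := hd
  norm_Φ_le := hb
  diskSup_lt := by
    rw [poissonIntegral_twist_zero, diskSup_zero]; norm_num
  center_lt := by
    rw [poissonIntegral_twist_zero, diskSup_zero, poissonIntegral_zero_of_differentiableOn hc hd]
    simpa using h0

/-- Along the radius, Φ(rη) = k(r + a)/(1 + ar) keeps the constant phase k, so equality holds in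
both Schwarz–Pick and the triangle inequality. -/
theorem exists_extremal {w η : ℂ} (hw : w ∈ ball (0 : ℂ) 1) (hη : η ∈ sphere (0 : ℂ) 1) :
    ∃ g φ Φ f : ℂ → ℂ, IsAdmissible g φ Φ f ∧ diskSup (poissonIntegral (twist φ)) = 0 ∧
      poissonIntegral Φ 0 = w ∧
      Tendsto (fun r : ℝ => ‖f (r * η)‖) (𝓝[<] (1 : ℝ)) (𝓝 1) ∧
      radialLiminf f η = ((schwarzBound φ Φ : ℝ) : EReal) := by
  have hη1 : ‖η‖ = 1 := by simpa using hη
  have hw1 : ‖w‖ < 1 := by simpa using hw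
  -- The phase of w; for w = 0 the convention `Complex.arg 0 = 0` gives k = 1.
  obtain ⟨k, hk, hkw⟩ : ∃ k : ℂ, ‖k‖ = 1 ∧ k * ‖w‖ = w := by
    refine ⟨Complex.exp (w.arg * Complex.I), Complex.norm_exp_ofReal_mul_I _, ?_⟩
    rw [mul_comm]; exact Complex.norm_mul_exp_arg_mul_I w
  set a := ‖w‖ with ha
  have ha0 : 0 ≤ a := norm_nonneg _
  set Φ : ℂ → ℂ := fun z => k * ((conj η * z + a) / (1 + a * (conj η * z))) with hΦ
  have hηη : conj η * η = 1 := by rw [Complex.conj_mul', hη1]; simp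
  have hden : ∀ z ∈ closedBall (0 : ℂ) 1, 1 + (a : ℂ) * (conj η * z) ≠ 0 := by
    intro z hz h
    have hz1 : ‖z‖ ≤ 1 := by simpa using hz
    have h1 : (a : ℂ) * (conj η * z) = -1 := by linear_combination h
    have h2 := congrArg norm h1
    rw [norm_mul, norm_mul, Complex.norm_conj, hη1, one_mul, norm_neg, norm_one,
      Complex.norm_real, Real.norm_eq_abs, abs_of_nonneg ha0] at h2
    nlinarith [norm_nonneg z]
  have hc : ContinuousOn Φ (closedBall 0 1) :=
    continuousOn_const.mul (ContinuousOn.div (by fun_prop) (by fun_prop) hden)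
  have hd : DifferentiableOn ℂ Φ (ball 0 1) :=
    (DifferentiableOn.div (by fun_prop) (by fun_prop)
      (fun z hz => hden z (ball_subset_closedBall hz))).const_mul k
  have hb : ∀ z ∈ closedBall (0 : ℂ) 1, ‖Φ z‖ ≤ 1 := by
    intro z hz
    have hz1 : ‖z‖ ≤ 1 := by simpa using hz
    simp only [hΦ]
    rw [norm_mul, hk, one_mul, norm_div]
    refine div_le_one_of_le₀ ?_ (norm_nonneg _)
    refine le_of_sq_le_sq ?_ (norm_nonneg _)
    have hid := norm_one_sub_conj_mul_sq (-a : ℂ) (conj η * z)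
    rw [norm_neg, Complex.norm_real, Real.norm_eq_abs, abs_of_nonneg ha0, norm_mul,
      Complex.norm_conj, hη1, one_mul, map_neg, Complex.conj_ofReal, neg_mul, sub_neg_eq_add,
      sub_neg_eq_add] at hid
    rw [hid]
    have h1 : a ^ 2 ≤ 1 := pow_le_one₀ ha0 hw1.le
    have h2 : ‖z‖ ^ 2 ≤ 1 := pow_le_one₀ (norm_nonneg _) hz1
    nlinarith
  have hΦ0 : Φ 0 = w := by simp [hΦ, hkw]
  have hΦη : Φ η = k := by
    have : (1 + a : ℂ) ≠ 0 := by exact_mod_cast (by positivity : (1 + a : ℝ) ≠ 0)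
    simp only [hΦ, hηη]
    rw [mul_one, div_self this, mul_one]
  have hadm : IsAdmissible 0 0 Φ Φ := isAdmissible_of_analytic hc hd hb (by rw [hΦ0]; exact hw1)
  have hcenter := poissonIntegral_zero_of_differentiableOn hc hd
  refine ⟨0, 0, Φ, Φ, hadm, ?_, by rw [hcenter, hΦ0], ?_, ?_⟩
  · rw [poissonIntegral_twist_zero, diskSup_zero]
  · have h1 := ((hadm.tendsto η hη).comp (tendsto_radial_nhdsWithin hη)).norm
    rw [hΦη, hk] at h1
    exact h1
  · rw [schwarzBound, hcenter, hΦ0, poissonIntegral_twist_zero, diskSup_zero, mul_zero, sub_zero,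
      ← ha, radialLiminf]
    refine Tendsto.liminf_eq ?_
    refine (continuous_coe_real_ereal.tendsto _).comp ?_
    have hcont : Tendsto (fun r : ℝ => (1 - a) / (1 + a * r)) (𝓝[<] 1) (𝓝 ((1 - a) / (1 + a))) := by
      have : ContinuousAt (fun r : ℝ => (1 - a) / (1 + a * r)) 1 :=
        ContinuousAt.div (by fun_prop) (by fun_prop) (by positivity)
      simpa [ContinuousAt] using this.tendsto.mono_left (nhdsWithin_le_nhds (s := Iio 1))
    refine hcont.congr' ?_
    filter_upwards [Ioo_mem_nhdsLT (zero_lt_one : (0 : ℝ) < 1)] with r hr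
    have hr1 : 0 < 1 - r := sub_pos.2 hr.2
    have hr0 := hr.1
    have hpos : 0 < 1 + a * r := by positivity
    have hval : Φ η - Φ (r * η) = k * (((1 - a) / (1 + a * r) * (1 - r) : ℝ) : ℂ) := by
      have h2 : (1 + a * r : ℂ) ≠ 0 := by exact_mod_cast hpos.ne'
      rw [hΦη]
      simp only [hΦ]
      rw [mul_left_comm (conj η) (r : ℂ) η, hηη, mul_one]
      push_cast
      refine mul_right_cancel₀ h2 ?_
      linear_combination -k * div_mul_cancel₀ ((r : ℂ) + a) h2
        - k * (1 - r) * div_mul_cancel₀ ((1 : ℂ) - a) h2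
    rw [hval, norm_mul, hk, one_mul, Complex.norm_real, Real.norm_eq_abs, abs_of_nonneg,
      mul_div_cancel_right₀ _ hr1.ne']
    have : 0 ≤ 1 - a := by linarith
    positivity

end BoundarySchwarz

end

/-- Boundary Schwarz lemma for solutions of the inhomogeneous biharmonic equation, followed by its
sharpness when `‖P_{φ₁}‖_∞ = 0`: for each value `w` in the open unit disk of `P_Φ(0)` and each
boundary point `η`, equality is attained. -/
theorem theorem2 :
    (∀ g φ Φ f : ℂ → ℂ, BoundarySchwarz.IsAdmissible g φ Φ f →
      ∀ η ∈ sphere (0 : ℂ) 1,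
        Tendsto (fun r : ℝ => ‖f (r * η)‖) (𝓝[<] (1 : ℝ)) (𝓝 1) →
          ((BoundarySchwarz.schwarzBound φ Φ : ℝ) : EReal) ≤
            BoundarySchwarz.radialLiminf f η) ∧
    (∀ w ∈ ball (0 : ℂ) 1, ∀ η ∈ sphere (0 : ℂ) 1,
      ∃ g φ Φ f : ℂ → ℂ, BoundarySchwarz.IsAdmissible g φ Φ f ∧
        BoundarySchwarz.diskSup
          (BoundarySchwarz.poissonIntegral (BoundarySchwarz.twist φ)) = 0 ∧
        BoundarySchwarz.poissonIntegral Φ 0 = w ∧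
        Tendsto (fun r : ℝ => ‖f (r * η)‖) (𝓝[<] (1 : ℝ)) (𝓝 1) ∧
        BoundarySchwarz.radialLiminf f η =
          ((BoundarySchwarz.schwarzBound φ Φ : ℝ) : EReal)) := by
  exact ⟨fun _ _ _ _ H _ hη hlim => BoundarySchwarz.schwarzBound_le_radialLiminf H hη hlim,
    fun _ hw _ hη => BoundarySchwarz.exists_extremal hw hη⟩
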